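/- For $n\ge 0$ let $$\delta_n=(-1)^n\sum_{k=0}^n\binom{2k}{k}\binom{2n-2k}{n-k}\binom nk^2$$ be the alternating Domb numbers. Let $p$ be a prime number, let $f_\delta=\sum_{n\ge0}\delta_n t^n\in\mathbb F_p[[t]]$ be the reduction modulo $p$ of their generating series, and set $$A_{\delta,p}=\sum_{n=0}^{p-1}\delta_n t^n\in\mathbb F_p[t].$$ Let $\mathbb F_p(t,f_\delta)$ be the subfield of $\mathbb F_p((t))$ generated by $f_\delta$ over $\mathbb F_p(t)$. For a subgroup $H$ of $\mathbb F_p^\times$, write $\mathrm{Gal}(\mathbb F_p(t,f_\delta)/\mathbb F_p(t))=H$ to mean that the extension is Galois, that $\sigma\mapsto\sigma(f_\delta)/f_\delta$ is an injective group homomorphism from its Galois group to $\mathbb F_p^\times$, and that the image of this homomorphism is $H$. Let $S\subseteq\mathbb F_p^\times$ be the subgroup of squares (for odd $p$ it is the unique subgroup of index $2$). Then there exists a polynomial $B_{\delta,p}\in\mathbb F_p[t]$ such that: - if $p\equiv1\pmod 6$, then $A_{\delta,p}=B_{\delta,p}^2$ and $\mathrm{Gal}(\mathbb F_p(t,f_\delta)/\mathbb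 F_p(t))=S$; - if $p\equiv5\pmod 6$, then $A_{\delta,p}=(64t^2+20t+1)\,B_{\delta,p}^2$ and $\mathrm{Gal}(\mathbb F_p(t,f_\delta)/\mathbb F_p(t))=\mathbb F_p^\times$. -/

import Mathlib

open scoped LaurentSeries

noncomputable section

/-- The alternating Domb numbers
`δ_n = (-1)^n ∑_{k=0}^n C(2k, k) C(2n-2k, n-k) C(n, k)^2`. -/
def dombAlt (n : ℕ) : ℤ :=
  (-1) ^ n * ∑ k ∈ Finset.range (n + 1),
    ((Nat.choose (2 * k) k : ℤ) * (Nat.choose (2 * (n - k)) (n - k) : ℤ) *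
      (Nat.choose n k : ℤ) ^ 2)

/-- The reduction modulo `p` of the generating series `f_δ = ∑ δ_n t^n`, in `F_p[[t]]`. -/
def dombSeries (p : ℕ) : PowerSeries (ZMod p) :=
  PowerSeries.mk fun n => (dombAlt n : ZMod p)

/-- The truncation `A_{δ,p} = ∑_{n=0}^{p-1} δ_n t^n`, in `F_p[t]`. -/
def dombTrunc (p : ℕ) : Polynomial (ZMod p) :=
  ∑ n ∈ Finset.range p, Polynomial.C (dombAlt n : ZMod p) * Polynomial.X ^ n

/-- `F_p((t))` as an extension of `F_p(t)`, through the expansion of rational functions as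
Laurent series at `t = 0`. -/
instance ratFuncLaurentAlgebra (p : ℕ) [Fact p.Prime] :
    Algebra (RatFunc (ZMod p)) (ZMod p)⸨X⸩ :=
  RatFunc.liftAlgebra (ZMod p) (ZMod p)⸨X⸩

/-- The field `F_p(t, f_δ)`: the subfield of `F_p((t))` generated by `f_δ` over the field
`F_p(t)` of rational functions. -/
def dombField (p : ℕ) [Fact p.Prime] :
    IntermediateField (RatFunc (ZMod p)) (ZMod p)⸨X⸩ :=
  IntermediateField.adjoin (RatFunc (ZMod p)) {(dombSeries p : (ZMod p)⸨X⸩)}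

/-- The series `f_δ` as an element of `F_p(t, f_δ)`. -/
def dombGen (p : ℕ) [Fact p.Prime] : dombField p :=
  ⟨(dombSeries p : (ZMod p)⸨X⸩), IntermediateField.mem_adjoin_simple_self _ _⟩

/-- The extension `F_p(t, f_δ) / F_p(t)` is Galois, the formula `σ ↦ σ(f_δ) / f_δ` defines an
injective group homomorphism from its Galois group to `F_p^×`, and the image of this
homomorphism is `H`. This is the meaning of `Gal(F_p(t, f_δ) / F_p(t)) = H`. -/
def DombGaloisGroupEq (p : ℕ) [Fact p.Prime] (H : Subgroup (ZMod p)ˣ) : Prop :=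
  IsGalois (RatFunc (ZMod p)) (dombField p) ∧
  ∃ ι : (dombField p ≃ₐ[RatFunc (ZMod p)] dombField p) →* (ZMod p)ˣ,
    (∀ σ, algebraMap (RatFunc (ZMod p)) (dombField p) (RatFunc.C (ι σ : ZMod p)) =
      σ (dombGen p) / dombGen p) ∧
    Function.Injective ι ∧ ι.range = H

end

/-! Write f for the series, A for its truncation and P = 64t² + 20t + 1 = (4t + 1)(16t + 1). A Lucas
congruence gives f = A f^p (`dombSeries_eq_dombTrunc_mul`), so f^(p-1) = 1/A. Since F_p contains all
(p-1)-th roots of unity, F_p(t, f) is a Kummer extension, governed by the multiplicities of the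
irreducible factors of A.

Over ℤ, f satisfies a linear differential equation of order three that has a quadratic first
integral, and this integral vanishes on f because its constant term is 0. Modulo p the factor f^p is
a constant for d/dt, so A satisfies the same quadratic equation (`dombQuadratic_dombTrunc`). Its
lowest-order term at an irreducible factor q of multiplicity m gives m(m-1) = 0 in F_p if q divides
P and m(m-2) = 0 otherwise. As deg A = p - 1, m < p, so m is 1 or 2 accordingly
(`multiplicity_dombTrunc`). By parity of the degree, A is B² or P B². The value A(-1/4) decides: in
a hypergeometric expansion of the Domb numbers only a term with 3k + 1 = p survives modulo p
(`sum_domb_mul_inv_four_pow_eq_zero_iff`).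

If the Galois image has order h, then f^h is rational, whence p - 1 divides h m for every
multiplicity m. Multiplicity 1 forces the full group, multiplicity 2 forces index at most 2. If A =
B², then f^((p-1)/2) B = ±1 confines the image to the squares. -/

/-! ### Recurrence of the Domb numbers by creative telescoping. -/

/-- The summand of the Domb numbers. -/
def dombTerm (n k : ℕ) : ℕ :=
  n.choose k ^ 2 * k.centralBinom * (n - k).centralBinom

/-- The Domb numbers. -/
def domb (n : ℕ) : ℕ := ∑ k ∈ Finset.range (n + 1), dombTerm n k

theorem dombAlt_eq_domb (n : ℕ) : dombAlt n = (-1) ^ n * (domb n : ℤ) := by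
  simp only [dombAlt, domb, dombTerm, Nat.centralBinom]
  push_cast
  congr 1
  exact Finset.sum_congr rfl fun k _ => by ring

theorem dombTerm_eq_zero_of_lt {n k : ℕ} (h : n < k) : dombTerm n k = 0 := by
  simp [dombTerm, Nat.choose_eq_zero_of_lt h]

theorem dombTerm_self_add_succ (k m : ℕ) :
    (dombTerm (k + m) k : ℚ) * (k + m + 1) ^ 2 * (2 * (2 * m + 1)) =
      dombTerm (k + m + 1) k * (m + 1) ^ 3 := by
  have h1 : ((k + m).choose k : ℚ) * (k + m + 1) = (k + m + 1).choose k * (m + 1) := by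
    have := Nat.choose_mul_succ_eq (k + m) k
    rw [show k + m + 1 - k = m + 1 by omega] at this
    exact_mod_cast this
  have h2 : ((m : ℚ) + 1) * (m + 1).centralBinom = 2 * (2 * m + 1) * m.centralBinom := by
    exact_mod_cast Nat.succ_mul_centralBinom_succ m
  simp only [dombTerm, show k + m + 1 - k = m + 1 by omega, show k + m - k = m by omega]
  push_cast
  linear_combination (((k + m).choose k : ℚ) * (k + m + 1) + (k + m + 1).choose k * (m + 1)) *
    k.centralBinom * m.centralBinom * (2 * (2 * m + 1)) * h1
    - ((k + m + 1).choose k * (m + 1 : ℚ)) ^ 2 * k.centralBinom * h2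

theorem dombTerm_succ_right (k m : ℕ) :
    (dombTerm (k + m) (k + 1) : ℚ) * (k + 1) ^ 3 * (2 * m - 1) =
      dombTerm (k + m) k * m ^ 3 * (2 * k + 1) := by
  obtain _ | m := m
  · simp [dombTerm_eq_zero_of_lt]
  have h1 : ((k + (m + 1)).choose (k + 1) : ℚ) * (k + 1) =
      (k + (m + 1)).choose k * (m + 1) := by
    have := Nat.choose_succ_right_eq (k + (m + 1)) k
    rw [show k + (m + 1) - k = m + 1 by omega] at this
    exact_mod_cast this
  have h2 : ((m : ℚ) + 1) * (m + 1).centralBinom = 2 * (2 * m + 1) * m.centralBinom := by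
    exact_mod_cast Nat.succ_mul_centralBinom_succ m
  have h3 : ((k : ℚ) + 1) * (k + 1).centralBinom = 2 * (2 * k + 1) * k.centralBinom := by
    exact_mod_cast Nat.succ_mul_centralBinom_succ k
  simp only [dombTerm, show k + (m + 1) - k = m + 1 by omega,
    show k + (m + 1) - (k + 1) = m by omega]
  push_cast
  linear_combination (((k + (m + 1)).choose (k + 1) : ℚ) * (k + 1) +
      (k + (m + 1)).choose k * (m + 1)) *
      (k + 1) * (k + 1).centralBinom * m.centralBinom * (2 * m + 1) * h1
    + ((k + (m + 1)).choose k * (m + 1 : ℚ)) ^ 2 * m.centralBinom * (2 * m + 1) * h3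
    - ((k + (m + 1)).choose k * (m + 1 : ℚ)) ^ 2 * k.centralBinom * (2 * k + 1) * h2

/-- The creative telescoping certificate of the recurrence of the Domb numbers. -/
def dombCert (n k : ℕ) : ℚ :=
  dombTerm (n + 2) k * k ^ 3 *
    (-56 + 74 * k - 30 * k ^ 2 + 4 * k ^ 3 - 104 * n + 89 * n * k - 18 * n * k ^ 2 - 62 * n ^ 2
      + 26 * n ^ 2 * k - 12 * n ^ 3) / ((n + 2) ^ 2 * (2 * (n + 2 - k) - 1))

theorem odd_cast_ne_zero (m : ℕ) : (2 * (m : ℚ) - 1) ≠ 0 := by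
  intro h
  have : 2 * m = 1 := by exact_mod_cast (sub_eq_zero.mp h)
  omega

/-- All the terms are rational multiples of `dombTerm (n + 2) k`, which leaves an identity of
rational functions in n and k. -/
theorem dombTerm_recurrence {n k : ℕ} (hk : k ≤ n + 2) :
    ((n : ℚ) + 2) ^ 3 * dombTerm (n + 2) k
      - 2 * (2 * n + 3) * (5 * (n + 1) ^ 2 + 5 * (n + 1) + 2) * dombTerm (n + 1) k
      + 64 * (n + 1) ^ 3 * dombTerm n k = dombCert n (k + 1) - dombCert n k := by
  -- With m = n + 2 - k the denominators become 2m - 1 and 2m - 3, odd integers that vanish for no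
  -- m.
  obtain ⟨m, hm⟩ := Nat.exists_eq_add_of_le hk
  have hn : (n : ℚ) = k + m - 2 := by
    have : (n : ℚ) + 2 = k + m := by exact_mod_cast hm
    linarith
  have hn2 : (n : ℚ) + 2 ≠ 0 := by positivity
  have hk1 : (k : ℚ) + 1 ≠ 0 := by positivity
  have ho := odd_cast_ne_zero m
  have hs := dombTerm_succ_right k m
  rw [← hm] at hs
  have hS : (dombTerm (n + 2) (k + 1) : ℚ) =
      dombTerm (n + 2) k * m ^ 3 * (2 * k + 1) / ((k + 1) ^ 3 * (2 * m - 1)) := by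
    rw [eq_div_iff (by positivity)]; linear_combination hs
  have ho' : (2 * (m : ℚ) - 3) ≠ 0 := by
    intro h
    have : 2 * m = 3 := by exact_mod_cast (sub_eq_zero.mp h)
    omega
  have h1 : (dombTerm (n + 1) k : ℚ) =
      dombTerm (n + 2) k * m ^ 3 / ((n + 2) ^ 2 * (2 * (2 * m - 1))) := by
    rw [eq_div_iff (by positivity)]
    -- For m = 0 the index k = n + 2 lies outside the support of the summand, and the factor m³
    -- vanishes as well.
    obtain _ | m := m
    · simp [dombTerm_eq_zero_of_lt (show n + 1 < k by omega)]
    · have := dombTerm_self_add_succ k m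
      rw [show k + m = n + 1 by omega] at this
      push_cast at hn ⊢
      rw [show (k : ℚ) = n + 2 - (m + 1) by linarith] at this
      linear_combination this
  have h0 : (dombTerm n k : ℚ) =
      dombTerm (n + 1) k * (m - 1) ^ 3 / ((n + 1) ^ 2 * (2 * (2 * m - 3))) := by
    rw [eq_div_iff (by positivity)]
    obtain _ | _ | m := m
    · simp [dombTerm_eq_zero_of_lt (show n + 1 < k by omega),
        dombTerm_eq_zero_of_lt (show n < k by omega)]
    · simp [dombTerm_eq_zero_of_lt (show n < k by omega)]
    · have := dombTerm_self_add_succ k m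
      rw [show k + m = n by omega] at this
      push_cast at hn ⊢
      rw [show (k : ℚ) = n + 2 - (m + 1 + 1) by linarith] at this
      linear_combination this
  have e1 : (2 * ((n : ℚ) + 2 - k) - 1) = 2 * m - 1 := by rw [hn]; ring
  have e2 : (2 * ((n : ℚ) + 2 - (k + 1)) - 1) = 2 * m - 3 := by rw [hn]; ring
  have hn1 : (n : ℚ) + 1 ≠ 0 := by positivity
  simp only [dombCert]
  push_cast
  rw [e1, e2, h0, h1, hS]
  have hK : (k : ℚ) = n + 2 - m := by linarith
  field_simp
  rw [hK]
  ring

theorem domb_eq_sum_range {n N : ℕ} (h : n + 1 ≤ N) :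
    domb n = ∑ k ∈ Finset.range N, dombTerm n k := by
  refine Finset.sum_subset (by simpa using h) fun k _ hk => dombTerm_eq_zero_of_lt ?_
  simpa using hk

theorem domb_recurrence (n : ℕ) :
    ((n : ℚ) + 2) ^ 3 * domb (n + 2)
      - 2 * (2 * n + 3) * (5 * (n + 1) ^ 2 + 5 * (n + 1) + 2) * domb (n + 1)
      + 64 * (n + 1) ^ 3 * domb n = 0 := by
  rw [domb_eq_sum_range (n := n + 2) le_rfl,
    domb_eq_sum_range (n := n + 1) (N := n + 2 + 1) (by omega),
    domb_eq_sum_range (n := n) (N := n + 2 + 1) (by omega)]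
  push_cast
  rw [Finset.mul_sum, Finset.mul_sum, Finset.mul_sum, ← Finset.sum_sub_distrib,
    ← Finset.sum_add_distrib, Finset.sum_congr rfl fun k hk => dombTerm_recurrence
      (Nat.lt_succ_iff.mp (Finset.mem_range.mp hk)), Finset.sum_range_sub]
  -- The certificate vanishes at both ends: at k = 0 by its factor k³, at k = n + 3 because its term
  -- does.
  simp [dombCert, dombTerm_eq_zero_of_lt]

/-! ### A hypergeometric expansion satisfying the same recurrence. -/

/-- The summand of the hypergeometric expansion of the Domb numbers. -/
def dombHyperTerm (n k : ℕ) : ℕ :=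
  k.centralBinom ^ 2 * (3 * k).choose k * (n + k).choose (3 * k) * 4 ^ (n - 2 * k)

theorem dombHyperTerm_eq_zero_of_lt {n k : ℕ} (h : n < 2 * k) : dombHyperTerm n k = 0 := by
  simp [dombHyperTerm, Nat.choose_eq_zero_of_lt (show n + k < 3 * k by omega)]

/-- With n = 2k + m the summand is a quotient of factorials, from which both shift ratios are read
off. -/
theorem dombHyperTerm_mul_factorial (k m : ℕ) :
    dombHyperTerm (2 * k + m) k * (k.factorial ^ 5 * m.factorial) =
      (2 * k).factorial * (3 * k + m).factorial * 4 ^ m := by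
  have h1 := Nat.choose_mul_factorial_mul_factorial (show 3 * k ≤ 3 * k + m by omega)
  have h2 := Nat.choose_mul_factorial_mul_factorial (show k ≤ 3 * k by omega)
  have h3 := Nat.choose_mul_factorial_mul_factorial (show k ≤ 2 * k by omega)
  rw [show 3 * k + m - 3 * k = m by omega] at h1
  rw [show 3 * k - k = 2 * k by omega] at h2
  rw [show 2 * k - k = k by omega, ← Nat.centralBinom_eq_two_mul_choose] at h3
  rw [dombHyperTerm, show 2 * k + m + k = 3 * k + m by omega,
    show 2 * k + m - 2 * k = m by omega, ← h1, ← h2]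
  nth_rewrite 2 [← h3]
  nth_rewrite 1 [← h3]
  ring

theorem dombHyperTerm_succ_left (k m : ℕ) :
    (dombHyperTerm (2 * k + m) k : ℚ) * (4 * (3 * k + m + 1)) =
      dombHyperTerm (2 * k + m + 1) k * (m + 1) := by
  have h1 := dombHyperTerm_mul_factorial k m
  have h2 := dombHyperTerm_mul_factorial k (m + 1)
  rw [← add_assoc, ← add_assoc, Nat.factorial_succ m, Nat.factorial_succ (3 * k + m)] at h2
  have h1' : (dombHyperTerm (2 * k + m) k : ℚ) * (k.factorial ^ 5 * m.factorial) =
    (2 * k).factorial * (3 * k + m).factorial * 4 ^ m := by exact_mod_cast h1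
  have h2' : (dombHyperTerm (2 * k + m + 1) k : ℚ) *
      (k.factorial ^ 5 * ((m + 1) * m.factorial)) =
    (2 * k).factorial * ((3 * k + m + 1) * (3 * k + m).factorial) * 4 ^ (m + 1) := by
    exact_mod_cast h2
  have hne : (k.factorial ^ 5 * m.factorial : ℚ) ≠ 0 := by positivity
  apply mul_right_cancel₀ hne
  rw [pow_succ] at h2'
  linear_combination (4 * (3 * k + m + 1) : ℚ) * h1' - h2'

theorem dombHyperTerm_succ_right (k m : ℕ) :
    (dombHyperTerm (2 * k + m) (k + 1) : ℚ) * (8 * (k + 1) ^ 4) =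
      dombHyperTerm (2 * k + m) k * ((2 * k + 1) * (3 * k + m + 1) * m * (m - 1)) := by
  obtain _ | _ | m := m
  · simp [dombHyperTerm_eq_zero_of_lt]
  · simp [dombHyperTerm_eq_zero_of_lt (show 2 * k + 1 < 2 * (k + 1) by omega)]
  have h1 := dombHyperTerm_mul_factorial k (m + 2)
  have h2 := dombHyperTerm_mul_factorial (k + 1) m
  rw [show 2 * (k + 1) + m = 2 * k + (m + 2) by ring, show 3 * (k + 1) + m = 3 * k + (m + 2) + 1
    by ring, Nat.factorial_succ k, Nat.factorial_succ (3 * k + (m + 2)),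
    show 2 * (k + 1) = 2 * k + 1 + 1 by ring, Nat.factorial_succ, Nat.factorial_succ (2 * k)] at h2
  rw [Nat.factorial_succ (m + 1), Nat.factorial_succ m] at h1
  have h1' : (dombHyperTerm (2 * k + (m + 2)) k : ℚ) *
      (k.factorial ^ 5 * ((m + 1 + 1) * ((m + 1) * m.factorial))) =
    (2 * k).factorial * (3 * k + (m + 2)).factorial * 4 ^ (m + 2) := by exact_mod_cast h1
  have h2' : (dombHyperTerm (2 * k + (m + 2)) (k + 1) : ℚ) *
      (((k + 1) * k.factorial) ^ 5 * m.factorial) =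
    ((2 * k + 1 + 1) * ((2 * k + 1) * (2 * k).factorial)) *
      ((3 * k + (m + 2) + 1) * (3 * k + (m + 2)).factorial) * 4 ^ m := by
    exact_mod_cast h2
  have hne : (k.factorial ^ 5 * m.factorial * (k + 1) : ℚ) ≠ 0 := by positivity
  apply mul_right_cancel₀ hne
  rw [pow_add] at h1'
  push_cast
  linear_combination 8 * h2' - (k + 1 : ℚ) * (2 * k + 1) * (3 * k + (m + 2) + 1) * h1'

/-- The creative telescoping certificate of the hypergeometric expansion. -/
def dombHyperCert (n k : ℕ) : ℚ :=
  dombHyperTerm (n + 2) k * k ^ 4 * (-48 - 36 * n) / ((n + 2 + k) * (n + 1 + k))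

theorem dombHyperTerm_recurrence (n k : ℕ) :
    ((n : ℚ) + 2) ^ 3 * dombHyperTerm (n + 2) k
      - 2 * (2 * n + 3) * (5 * (n + 1) ^ 2 + 5 * (n + 1) + 2) * dombHyperTerm (n + 1) k
      + 64 * (n + 1) ^ 3 * dombHyperTerm n k = dombHyperCert n (k + 1) - dombHyperCert n k := by
  obtain hk | hk := lt_or_ge (n + 2) (2 * k)
  · simp [dombHyperCert, dombHyperTerm_eq_zero_of_lt hk,
      dombHyperTerm_eq_zero_of_lt (show n + 1 < 2 * k by omega),
      dombHyperTerm_eq_zero_of_lt (show n < 2 * k by omega),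
      dombHyperTerm_eq_zero_of_lt (show n + 2 < 2 * (k + 1) by omega)]
  obtain ⟨m, hm⟩ := Nat.exists_eq_add_of_le hk
  have hn : (m : ℚ) = n + 2 - 2 * k := by
    have : (n : ℚ) + 2 = 2 * k + m := by exact_mod_cast hm
    linarith
  have hs := dombHyperTerm_succ_right k m
  rw [← hm, show (3 * k + m + 1 : ℚ) = n + 3 + k by rw [hn]; ring] at hs
  have hS : (dombHyperTerm (n + 2) (k + 1) : ℚ) =
      dombHyperTerm (n + 2) k * ((2 * k + 1) * (n + 3 + k) * m * (m - 1)) /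
        (8 * (k + 1) ^ 4) := by
    rw [eq_div_iff (by positivity)]; linear_combination hs
  have h1 : (dombHyperTerm (n + 1) k : ℚ) =
      dombHyperTerm (n + 2) k * m / (4 * (n + 2 + k)) := by
    rw [eq_div_iff (by positivity)]
    obtain _ | m := m
    · simp [dombHyperTerm_eq_zero_of_lt (show n + 1 < 2 * k by omega)]
    · have := dombHyperTerm_succ_left k m
      rw [show 2 * k + m = n + 1 by omega] at this
      push_cast at hn ⊢
      linear_combination this - dombHyperTerm (n + 1) k * 4 * hn
  have h0 : (dombHyperTerm n k : ℚ) =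
      dombHyperTerm (n + 1) k * (m - 1) / (4 * (n + 1 + k)) := by
    rw [eq_div_iff (by positivity)]
    obtain _ | _ | m := m
    · simp [dombHyperTerm_eq_zero_of_lt (show n + 1 < 2 * k by omega),
        dombHyperTerm_eq_zero_of_lt (show n < 2 * k by omega)]
    · simp [dombHyperTerm_eq_zero_of_lt (show n < 2 * k by omega)]
    · have := dombHyperTerm_succ_left k m
      rw [show 2 * k + m = n by omega] at this
      push_cast at hn ⊢
      linear_combination this - dombHyperTerm n k * 4 * hn
  have a1 : (n : ℚ) + 1 + k ≠ 0 := by positivity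
  have a2 : (n : ℚ) + 2 + k ≠ 0 := by positivity
  have a3 : (n : ℚ) + 3 + k ≠ 0 := by positivity
  have a4 : (k : ℚ) + 1 ≠ 0 := by positivity
  simp only [dombHyperCert]
  push_cast
  rw [h0, h1, hS, show (n : ℚ) + 2 + (k + 1) = n + 3 + k by ring,
    show (n : ℚ) + 1 + (k + 1) = n + 2 + k by ring]
  field_simp
  rw [hn]
  ring

theorem sum_dombHyperTerm_eq {n N N' : ℕ} (h : n + 1 ≤ N) (h' : N ≤ N') :
    ∑ k ∈ Finset.range N, dombHyperTerm n k = ∑ k ∈ Finset.range N', dombHyperTerm n k := by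
  refine Finset.sum_subset (by simpa using h') fun k _ hk => dombHyperTerm_eq_zero_of_lt ?_
  have : N ≤ k := by simpa using hk
  omega

theorem sum_dombHyperTerm_recurrence (n : ℕ) :
    ((n : ℚ) + 2) ^ 3 * ((∑ k ∈ Finset.range (n + 2 + 1), dombHyperTerm (n + 2) k : ℕ) : ℚ)
      - 2 * (2 * n + 3) * (5 * (n + 1) ^ 2 + 5 * (n + 1) + 2) *
        ((∑ k ∈ Finset.range (n + 1 + 1), dombHyperTerm (n + 1) k : ℕ) : ℚ)
      + 64 * (n + 1) ^ 3 * ((∑ k ∈ Finset.range (n + 1), dombHyperTerm n k : ℕ) : ℚ) = 0 := by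
  rw [sum_dombHyperTerm_eq (n := n + 1) (N' := n + 2 + 1) le_rfl (by omega),
    sum_dombHyperTerm_eq (n := n) (N' := n + 2 + 1) le_rfl (by omega)]
  push_cast
  rw [Finset.mul_sum, Finset.mul_sum, Finset.mul_sum, ← Finset.sum_sub_distrib,
    ← Finset.sum_add_distrib, Finset.sum_congr rfl fun k _ => dombHyperTerm_recurrence n k,
    Finset.sum_range_sub]
  simp [dombHyperCert, dombHyperTerm_eq_zero_of_lt (show n + 2 < 2 * (n + 2 + 1) by omega)]

/-- Both sides agree at 0 and 1 and obey one recurrence, whose leading coefficient (n + 2)³ never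
vanishes. -/
theorem domb_eq_sum_dombHyperTerm (n : ℕ) :
    domb n = ∑ k ∈ Finset.range (n + 1), dombHyperTerm n k := by
  induction n using Nat.twoStepInduction with
  | zero => decide +kernel
  | one => decide +kernel
  | more n h0 h1 =>
    have e := domb_recurrence n
    have e' := sum_dombHyperTerm_recurrence n
    rw [← h0, ← h1] at e'
    have hne : ((n : ℚ) + 2) ^ 3 ≠ 0 := by positivity
    have : (domb (n + 2) : ℚ) =
        ((∑ k ∈ Finset.range (n + 2 + 1), dombHyperTerm (n + 2) k : ℕ) : ℚ) :=
      mul_left_cancel₀ hne (by linear_combination e - e')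
    exact_mod_cast this

/-! ### Lucas congruences and the value at -1/4 modulo p. -/

section Congruences

variable {p : ℕ} [Fact p.Prime]

theorem cast_choose_add_mul {a i : ℕ} (b j : ℕ) (ha : a < p) (hi : i < p) :
    (((a + p * b).choose (i + p * j) : ℕ) : ZMod p) = a.choose i * b.choose j := by
  have h := Choose.choose_modEq_choose_mod_mul_choose_div_nat (n := a + p * b) (k := i + p * j)
    (p := p)
  have hp : 0 < p := (Fact.out : p.Prime).pos
  rw [Nat.add_mul_mod_self_left, Nat.add_mul_mod_self_left, Nat.add_mul_div_left _ _ hp,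
    Nat.add_mul_div_left _ _ hp, Nat.mod_eq_of_lt ha, Nat.mod_eq_of_lt hi,
    Nat.div_eq_of_lt ha, Nat.div_eq_of_lt hi, zero_add, zero_add] at h
  exact_mod_cast (ZMod.natCast_eq_natCast_iff _ _ _).mpr h

theorem cast_centralBinom_eq_zero {i : ℕ} (h : p ≤ 2 * i) (hi : i < p) :
    (i.centralBinom : ZMod p) = 0 := by
  obtain ⟨r, hr⟩ := Nat.exists_eq_add_of_le h
  have hri : r < i := by omega
  have := cast_choose_add_mul (p := p) 1 0 (hri.trans hi) hi
  rw [mul_one, mul_zero, add_zero, add_comm r p, ← hr, Nat.choose_eq_zero_of_lt hri] at this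
  simpa [Nat.centralBinom] using this

/-- If doubling the digit i produces a carry, both sides vanish; otherwise this is Lucas' theorem.
-/
theorem cast_centralBinom_add_mul {i : ℕ} (j : ℕ) (hi : i < p) :
    ((i + p * j).centralBinom : ZMod p) = i.centralBinom * j.centralBinom := by
  obtain h | h := lt_or_ge (2 * i) p
  · rw [Nat.centralBinom, show 2 * (i + p * j) = 2 * i + p * (2 * j) by ring,
      cast_choose_add_mul _ _ h hi, Nat.centralBinom, Nat.centralBinom]
  · obtain ⟨r, hr⟩ := Nat.exists_eq_add_of_le h
    have hri : r < i := by omega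
    rw [cast_centralBinom_eq_zero h hi, zero_mul, Nat.centralBinom,
      show 2 * (i + p * j) = r + p * (2 * j + 1) by rw [mul_add, hr]; ring,
      cast_choose_add_mul _ _ (hri.trans hi) hi, Nat.choose_eq_zero_of_lt hri]
    simp

theorem cast_dombTerm_add_mul {a i : ℕ} (b j : ℕ) (ha : a < p) (hi : i < p) :
    (dombTerm (a + p * b) (i + p * j) : ZMod p) = dombTerm a i * dombTerm b j := by
  simp only [dombTerm, Nat.cast_mul, Nat.cast_pow]
  rw [cast_choose_add_mul b j ha hi]
  obtain h | h := lt_or_ge a i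
  · simp [Nat.choose_eq_zero_of_lt h]
  obtain h' | h' := lt_or_ge b j
  · simp [Nat.choose_eq_zero_of_lt h']
  have e : a + p * b - (i + p * j) = (a - i) + p * (b - j) := by
    obtain ⟨c, rfl⟩ := Nat.exists_eq_add_of_le h
    obtain ⟨d, rfl⟩ := Nat.exists_eq_add_of_le h'
    simp only [Nat.add_sub_cancel_left]
    rw [mul_add]
    omega
  rw [e, cast_centralBinom_add_mul j hi, cast_centralBinom_add_mul (b - j) (by omega)]
  ring

theorem sum_range_mul_eq_sum_sum {M : Type*} [AddCommMonoid M] (f : ℕ → M) (p b : ℕ) :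
    ∑ k ∈ Finset.range (p * b), f k =
      ∑ j ∈ Finset.range b, ∑ i ∈ Finset.range p, f (i + p * j) := by
  induction b with
  | zero => simp
  | succ b ih =>
    rw [mul_add, mul_one, Finset.sum_range_add, ih, Finset.sum_range_succ]
    simp [add_comm]

theorem cast_domb_add_mul {a : ℕ} (b : ℕ) (ha : a < p) :
    (domb (a + p * b) : ZMod p) = domb a * domb b := by
  -- The range is padded with zero terms to full blocks of length p, so that k = i + pj has
  -- independent digits.
  rw [domb_eq_sum_range (n := a + p * b) (N := p * (b + 1)) (by rw [mul_add]; omega),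
    domb_eq_sum_range (n := a) (N := p) (by omega), domb, sum_range_mul_eq_sum_sum]
  push_cast
  rw [Finset.sum_mul_sum, Finset.sum_comm]
  exact Finset.sum_congr rfl fun i hi => Finset.sum_congr rfl fun j _ =>
    cast_dombTerm_add_mul b j ha (Finset.mem_range.mp hi)

theorem cast_dombAlt (n : ℕ) : (dombAlt n : ZMod p) = (-1) ^ n * domb n := by
  rw [dombAlt_eq_domb]; push_cast; rfl

theorem cast_dombAlt_add_mul {a : ℕ} (b : ℕ) (ha : a < p) :
    (dombAlt (a + p * b) : ZMod p) = dombAlt a * dombAlt b := by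
  rw [cast_dombAlt, cast_dombAlt, cast_dombAlt, cast_domb_add_mul b ha, pow_add, pow_mul,
    ZMod.pow_card]
  ring

theorem cast_choose_ne_zero {a i : ℕ} (ha : a < p) (hi : i ≤ a) :
    (a.choose i : ZMod p) ≠ 0 := by
  rw [Ne, ZMod.natCast_eq_zero_iff]
  intro h
  have := (Nat.choose_mul_factorial_mul_factorial hi) ▸
    ((h.mul_right i.factorial).mul_right (a - i).factorial)
  exact absurd (((Fact.out : p.Prime).dvd_factorial).mp this) (by omega)

theorem cast_centralBinom_ne_zero {i : ℕ} (h : 2 * i < p) : (i.centralBinom : ZMod p) ≠ 0 :=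
  cast_choose_ne_zero h (by omega)

/-- One of the two central binomials vanishes modulo p unless k = (p - 1)/2. This fixes the degree
of the truncation. -/
theorem cast_domb_pred_ne_zero (hp : Odd p) : (domb (p - 1) : ZMod p) ≠ 0 := by
  obtain ⟨r, hr⟩ := hp
  have hp1 : 1 < p := (Fact.out : p.Prime).one_lt
  rw [domb, Nat.cast_sum, Finset.sum_eq_single r]
  · have e : p - 1 - r = r := by omega
    rw [dombTerm, e]
    push_cast
    exact mul_ne_zero (mul_ne_zero (pow_ne_zero _ (cast_choose_ne_zero (by omega)
      (by omega))) (cast_centralBinom_ne_zero (by omega))) (cast_centralBinom_ne_zero (by omega))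
  · intro k hk hkr
    have hk : k < p := by have := Finset.mem_range.mp hk; omega
    rw [dombTerm]
    push_cast
    obtain h | h := lt_or_ge r k
    · rw [cast_centralBinom_eq_zero (i := k) (by omega) hk]; simp
    · rw [cast_centralBinom_eq_zero (i := p - 1 - k) (by omega) (by omega)]; simp
  · intro h; exact absurd (Finset.mem_range.mpr (by omega)) h

theorem sum_range_choose_add (p k : ℕ) :
    ∑ n ∈ Finset.range p, (n + k).choose (3 * k) = (p + k).choose (3 * k + 1) := by
  induction p with
  | zero => simp [Nat.choose_eq_zero_of_lt (show k < 3 * k + 1 by omega)]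
  | succ p ih =>
    rw [Finset.sum_range_succ, ih, show p + 1 + k = p + k + 1 by ring, Nat.choose_succ_succ' (p + k),
      add_comm]

/-- By Lucas, the second binomial vanishes when 3k + 1 < p and the first when 3k + 1 > p > 2k; for
2k ≥ p the second is already 0 in ℕ. -/
theorem cast_hyper_coeff_eq_zero {k : ℕ} (hk : k < p) (h : 3 * k + 1 ≠ p) :
    (((3 * k).choose k * (p + k).choose (3 * k + 1) : ℕ) : ZMod p) = 0 := by
  obtain h2 | h2 := le_or_gt p (2 * k)
  · rw [Nat.choose_eq_zero_of_lt (show p + k < 3 * k + 1 by omega)]; simp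
  obtain h3 | h3 := lt_or_gt_of_ne h
  · have := cast_choose_add_mul (p := p) 1 0 hk h3
    rw [mul_one, mul_zero, add_zero, add_comm k p,
      Nat.choose_eq_zero_of_lt (show k < 3 * k + 1 by omega)] at this
    rw [Nat.cast_mul, this]; simp
  · have := cast_choose_add_mul (p := p) (a := 3 * k - p) 1 0 (by omega) hk
    rw [mul_one, mul_zero, add_zero, Nat.sub_add_cancel (by omega),
      Nat.choose_eq_zero_of_lt (show 3 * k - p < k by omega)] at this
    rw [Nat.cast_mul, this]; simp

theorem four_ne_zero_of_odd (hp : Odd p) : (4 : ZMod p) ≠ 0 := by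
  intro h
  have h4 : ((2 ^ 2 : ℕ) : ZMod p) = 0 := by push_cast; linear_combination h
  have := (Fact.out : p.Prime).dvd_of_dvd_pow ((ZMod.natCast_eq_zero_iff _ _).mp h4)
  have := (Nat.prime_dvd_prime_iff_eq Fact.out Nat.prime_two).mp this
  subst this
  exact absurd hp (by decide)

/-- The weight 4⁻ⁿ cancels the power of 4 that depends on n, and the hockey-stick identity then sums
over n. -/
theorem sum_domb_mul_inv_four_pow (hp : Odd p) :
    ∑ n ∈ Finset.range p, (domb n : ZMod p) * 4⁻¹ ^ n =
      ∑ k ∈ Finset.range p, (k.centralBinom : ZMod p) ^ 2 * 4⁻¹ ^ (2 * k) *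
        ((3 * k).choose k * (p + k).choose (3 * k + 1) : ℕ) := by
  have h4 := four_ne_zero_of_odd hp
  have e : ∀ n ∈ Finset.range p, (domb n : ZMod p) * 4⁻¹ ^ n =
      ∑ k ∈ Finset.range p, (k.centralBinom : ZMod p) ^ 2 * 4⁻¹ ^ (2 * k) *
        ((3 * k).choose k * (n + k).choose (3 * k) : ℕ) := by
    intro n hn
    rw [domb_eq_sum_dombHyperTerm, sum_dombHyperTerm_eq le_rfl (Finset.mem_range.mp hn),
      Nat.cast_sum, Finset.sum_mul]
    refine Finset.sum_congr rfl fun k _ => ?_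
    obtain h | h := lt_or_ge n (2 * k)
    · rw [dombHyperTerm_eq_zero_of_lt h, Nat.choose_eq_zero_of_lt (show n + k < 3 * k by omega)]
      simp
    · rw [dombHyperTerm]
      obtain ⟨m, rfl⟩ := Nat.exists_eq_add_of_le h
      rw [Nat.add_sub_cancel_left, pow_add]
      have : (4 : ZMod p) ^ m * 4⁻¹ ^ m = 1 := by rw [← mul_pow, mul_inv_cancel₀ h4, one_pow]
      push_cast
      linear_combination (k.centralBinom : ZMod p) ^ 2 * 4⁻¹ ^ (2 * k) * (3 * k).choose k *
        (2 * k + m + k).choose (3 * k) * this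
  rw [Finset.sum_congr rfl e, Finset.sum_comm]
  refine Finset.sum_congr rfl fun k _ => ?_
  rw [← Finset.mul_sum, ← Nat.cast_sum, ← Finset.mul_sum, sum_range_choose_add]

theorem sum_domb_mul_inv_four_pow_eq_zero_iff (hp : Odd p) :
    ∑ n ∈ Finset.range p, (domb n : ZMod p) * 4⁻¹ ^ n = 0 ↔ p % 3 ≠ 1 := by
  rw [sum_domb_mul_inv_four_pow hp]
  constructor
  · intro h h3
    have hp1 : 1 < p := (Fact.out : p.Prime).one_lt
    obtain ⟨k, hk⟩ : ∃ k, p = 3 * k + 1 := ⟨p / 3, by omega⟩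
    rw [Finset.sum_eq_single k] at h
    · revert h
      have h1 : (((p + k).choose (3 * k + 1) : ℕ) : ZMod p) = 1 := by
        have := cast_choose_add_mul (p := p) (a := k) (i := 0) 1 1 (by omega) (by omega)
        rw [mul_one, zero_add, add_comm k p] at this
        rw [← hk, this]; simp
      rw [Nat.cast_mul, h1]
      exact mul_ne_zero (mul_ne_zero (pow_ne_zero _ (cast_centralBinom_ne_zero (by omega)))
        (pow_ne_zero _ (inv_ne_zero (four_ne_zero_of_odd hp))))
        (mul_ne_zero (cast_choose_ne_zero (by omega) (by omega)) one_ne_zero)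
    · intro j hj hjk
      rw [cast_hyper_coeff_eq_zero (Finset.mem_range.mp hj) (by omega), mul_zero]
    · intro h; exact absurd (Finset.mem_range.mpr (by omega)) h
  · intro h
    refine Finset.sum_eq_zero fun k hk => ?_
    rw [cast_hyper_coeff_eq_zero (Finset.mem_range.mp hk) (by omega), mul_zero]

end Congruences

/-! ### The differential equation and its quadratic first integral. -/

namespace PowerSeries

variable {R : Type*} [CommRing R]

/-- The Euler derivation `X d/dX` on formal power series. -/
noncomputable def eulerDeriv (R : Type*) [CommRing R] : Derivation R R⟦X⟧ R⟦X⟧ :=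
  (X : R⟦X⟧) • derivative R

theorem eulerDeriv_apply (f : R⟦X⟧) : eulerDeriv R f = X * derivative R f := rfl

@[simp]
theorem coeff_eulerDeriv (f : R⟦X⟧) (n : ℕ) : coeff n (eulerDeriv R f) = n * coeff n f := by
  rw [eulerDeriv_apply]
  obtain _ | n := n
  · simp
  · rw [mul_comm, coeff_succ_mul_X, coeff_derivative]
    push_cast; ring

theorem eulerDeriv_X : eulerDeriv R X = X := by
  rw [eulerDeriv_apply, derivative_X, mul_one]

theorem eulerDeriv_ofNat (n : ℕ) [n.AtLeastTwo] :
    eulerDeriv R (OfNat.ofNat n : R⟦X⟧) = 0 := by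
  rw [← Nat.cast_ofNat (R := R⟦X⟧)]
  exact Derivation.map_natCast _ _

theorem map_eulerDeriv {S : Type*} [CommRing S] (φ : R →+* S) (f : R⟦X⟧) :
    map φ (eulerDeriv R f) = eulerDeriv S (map φ f) := by
  ext n; simp

theorem eulerDeriv_coe (f : Polynomial R) :
    eulerDeriv R (f : R⟦X⟧) = ((Polynomial.X * Polynomial.derivative f : Polynomial R) : R⟦X⟧) := by
  rw [eulerDeriv_apply, derivative_coe]; simp

/-- The quadratic differential operator of order two attached to the alternating Domb numbers. -/
noncomputable def dombQuadratic (f : R⟦X⟧) : R⟦X⟧ :=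
  (1 + 20 * X + 64 * X ^ 2) * (2 * f * eulerDeriv R (eulerDeriv R f) - eulerDeriv R f ^ 2)
    + (20 * X + 128 * X ^ 2) * f * eulerDeriv R f + (8 * X + 64 * X ^ 2) * f ^ 2

/-- The last factor is the order-three operator annihilating the generating series, so
`dombQuadratic` is a first integral of it. -/
theorem eulerDeriv_dombQuadratic (f : R⟦X⟧) :
    eulerDeriv R (dombQuadratic f) = 2 * f *
      ((1 + 20 * X + 64 * X ^ 2) * eulerDeriv R (eulerDeriv R (eulerDeriv R f))
        + (30 * X + 192 * X ^ 2) * eulerDeriv R (eulerDeriv R f)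
        + (18 * X + 192 * X ^ 2) * eulerDeriv R f + (4 * X + 64 * X ^ 2) * f) := by
  have e2 : eulerDeriv R 2 = 0 := eulerDeriv_ofNat 2
  have e8 : eulerDeriv R 8 = 0 := eulerDeriv_ofNat 8
  have e20 : eulerDeriv R 20 = 0 := eulerDeriv_ofNat 20
  have e64 : eulerDeriv R 64 = 0 := eulerDeriv_ofNat 64
  have e128 : eulerDeriv R 128 = 0 := eulerDeriv_ofNat 128
  simp only [dombQuadratic, map_add, map_sub, Derivation.leibniz, Derivation.leibniz_pow,
    eulerDeriv_X, e2, e8, e20, e64, e128, Derivation.map_one_eq_zero, smul_eq_mul, nsmul_eq_mul]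
  push_cast
  ring

theorem map_dombQuadratic {S : Type*} [CommRing S] (φ : R →+* S) (f : R⟦X⟧) :
    map φ (dombQuadratic f) = dombQuadratic (map φ f) := by
  have e2 : map φ 2 = 2 := map_ofNat _ 2
  have e8 : map φ 8 = 8 := map_ofNat _ 8
  have e20 : map φ 20 = 20 := map_ofNat _ 20
  have e64 : map φ 64 = 64 := map_ofNat _ 64
  have e128 : map φ 128 = 128 := map_ofNat _ 128
  simp [dombQuadratic, map_eulerDeriv, e2, e8, e20, e64, e128]

theorem dombQuadratic_mul_of_eulerDeriv_eq_zero {g : R⟦X⟧} (hg : eulerDeriv R g = 0) (f : R⟦X⟧) :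
    dombQuadratic (f * g) = dombQuadratic f * g ^ 2 := by
  simp only [dombQuadratic, Derivation.leibniz, hg, smul_eq_mul, mul_zero, zero_add]
  ring

theorem eq_zero_of_eulerDeriv_eq_zero [IsDomain R] [CharZero R] {f : R⟦X⟧}
    (h : eulerDeriv R f = 0) (h0 : constantCoeff f = 0) : f = 0 := by
  ext n
  obtain rfl | hn := eq_or_ne n 0
  · simpa using h0
  · have := congrArg (coeff n) h
    rw [coeff_eulerDeriv, map_zero, mul_eq_zero] at this
    simpa [hn] using this

end PowerSeries

theorem dombAlt_recurrence (n : ℕ) :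
    ((n : ℤ) + 2) ^ 3 * dombAlt (n + 2)
      + 2 * (2 * n + 3) * (5 * (n + 1) ^ 2 + 5 * (n + 1) + 2) * dombAlt (n + 1)
      + 64 * (n + 1) ^ 3 * dombAlt n = 0 := by
  have h := domb_recurrence n
  have h' : ((n : ℤ) + 2) ^ 3 * domb (n + 2)
      - 2 * (2 * n + 3) * (5 * (n + 1) ^ 2 + 5 * (n + 1) + 2) * domb (n + 1)
      + 64 * (n + 1) ^ 3 * domb n = 0 := by exact_mod_cast h
  rw [dombAlt_eq_domb, dombAlt_eq_domb, dombAlt_eq_domb]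
  linear_combination (-1) ^ n * h'

open PowerSeries in
theorem dombAlt_differential_equation :
    let f : ℤ⟦X⟧ := PowerSeries.mk dombAlt
    (1 + 20 * X + 64 * X ^ 2) * eulerDeriv ℤ (eulerDeriv ℤ (eulerDeriv ℤ f))
        + (30 * X + 192 * X ^ 2) * eulerDeriv ℤ (eulerDeriv ℤ f)
        + (18 * X + 192 * X ^ 2) * eulerDeriv ℤ f + (4 * X + 64 * X ^ 2) * f = 0 := by
  intro f
  -- Grouping by powers of X turns each group into a shift of the index when coefficients are taken.
  have key : ∀ g : ℕ → ℤ⟦X⟧, (1 + 20 * X + 64 * X ^ 2) * g 3 + (30 * X + 192 * X ^ 2) * g 2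
      + (18 * X + 192 * X ^ 2) * g 1 + (4 * X + 64 * X ^ 2) * g 0 =
      g 3 + (C (20 : ℤ) * g 3 + C (30 : ℤ) * g 2 + C (18 : ℤ) * g 1 + C (4 : ℤ) * g 0) * X +
      (C (64 : ℤ) * g 3 + C (192 : ℤ) * g 2 + C (192 : ℤ) * g 1 + C (64 : ℤ) * g 0) * X ^ 2 := by
    intro g
    have e (n : ℕ) [n.AtLeastTwo] : C (OfNat.ofNat n : ℤ) = (OfNat.ofNat n : ℤ⟦X⟧) :=
      map_ofNat C n
    rw [e 4, e 18, e 20, e 30, e 64, e 192]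
    ring
  have := key fun i => (eulerDeriv ℤ)^[i] f
  simp only [Function.iterate_succ, Function.iterate_zero, Function.comp_apply, id] at this
  rw [this]
  ext n
  have h0 : dombAlt 0 = 1 := by decide +kernel
  have h1 : dombAlt 1 = -4 := by decide +kernel
  obtain _ | _ | n := n
  · simp [f, eulerDeriv_apply]
  · rw [map_add, map_add, coeff_succ_mul_X, coeff_mul_X_pow', if_neg (by omega)]
    simp only [map_add, coeff_C_mul, coeff_eulerDeriv, f, coeff_mk, map_zero]
    norm_num [h0, h1]
  · rw [map_add, map_add, coeff_succ_mul_X, show n + 1 + 1 = n + 2 from rfl, coeff_mul_X_pow]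
    simp only [map_add, coeff_C_mul, coeff_eulerDeriv, f, coeff_mk, map_zero]
    push_cast
    linear_combination dombAlt_recurrence n

open PowerSeries in
-- The argument needs characteristic 0: modulo p the Euler derivation also kills all series in X^p.
theorem dombQuadratic_dombAlt : dombQuadratic (PowerSeries.mk dombAlt : ℤ⟦X⟧) = 0 := by
  apply eq_zero_of_eulerDeriv_eq_zero
  · rw [eulerDeriv_dombQuadratic, dombAlt_differential_equation, mul_zero]
  · simp [dombQuadratic, eulerDeriv_apply]

/-! ### Reduction modulo p: the quadratic equation for the truncation. -/

section Reduction

open PowerSeries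

variable (p : ℕ)

theorem dombQuadratic_dombSeries : dombQuadratic (dombSeries p) = 0 := by
  have : dombSeries p = PowerSeries.map (Int.castRingHom (ZMod p)) (PowerSeries.mk dombAlt) := by
    ext n; simp [dombSeries]
  rw [this, ← map_dombQuadratic, dombQuadratic_dombAlt, map_zero]

theorem coeff_dombTrunc (n : ℕ) :
    (dombTrunc p).coeff n = if n < p then (dombAlt n : ZMod p) else 0 := by
  simp [dombTrunc, Polynomial.coeff_X_pow]

theorem dombAlt_zero : dombAlt 0 = 1 := by decide +kernel

variable [Fact p.Prime]

theorem dombSeries_pow_eq_expand :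
    dombSeries p ^ p = expand p (NeZero.ne p) (dombSeries p) := by
  have h : PowerSeries.map (frobenius (ZMod p) p) (expand p (NeZero.ne p) (dombSeries p)) =
      dombSeries p ^ p :=
    MvPowerSeries.map_frobenius_expand p (NeZero.ne p)
  rw [← h, ZMod.frobenius_zmod, PowerSeries.map_id]
  rfl

theorem dombSeries_eq_dombTrunc_mul :
    dombSeries p = (dombTrunc p : (ZMod p)⟦X⟧) * dombSeries p ^ p := by
  have hp : 0 < p := (Fact.out : p.Prime).pos
  ext n
  rw [dombSeries_pow_eq_expand, coeff_mul, Finset.sum_eq_single (n % p, p * (n / p))]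
  · rw [coeff_expand_mul, Polynomial.coeff_coe, coeff_dombTrunc, if_pos (Nat.mod_lt _ hp)]
    simp only [dombSeries, coeff_mk]
    rw [← cast_dombAlt_add_mul _ (Nat.mod_lt _ hp), Nat.mod_add_div]
  · rintro ⟨i, j⟩ hij hne
    rw [Polynomial.coeff_coe, coeff_dombTrunc]
    split_ifs with hi
    · rw [coeff_expand_of_not_dvd, mul_zero]
      rintro ⟨q, rfl⟩
      apply hne
      have : i + p * q = n := by simpa using hij
      rw [← this, Nat.add_mul_mod_self_left, Nat.add_mul_div_left _ _ hp, Nat.mod_eq_of_lt hi,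
        Nat.div_eq_of_lt hi, zero_add]
    · simp
  · intro h
    exact absurd (Finset.HasAntidiagonal.mem_antidiagonal.mpr (Nat.mod_add_div n p)) h

theorem dombSeries_ne_zero : dombSeries p ≠ 0 := by
  intro h
  have := congrArg (coeff 0) h
  simp [dombSeries, dombAlt_zero] at this

/-- In f = A f^p the factor f^p has zero derivative, and `dombQuadratic` is homogeneous of degree 2,
so f^p factors out squared. -/
theorem dombQuadratic_dombTrunc : dombQuadratic (dombTrunc p : (ZMod p)⟦X⟧) = 0 := by
  have h := dombQuadratic_dombSeries p
  rw [dombSeries_eq_dombTrunc_mul, dombQuadratic_mul_of_eulerDeriv_eq_zero] at h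
  · exact (mul_eq_zero.mp h).resolve_right
      (pow_ne_zero _ (pow_ne_zero _ (dombSeries_ne_zero p)))
  · have : ((p : ℕ) : (ZMod p)⟦X⟧) = 0 := by
      rw [← map_natCast (C (R := ZMod p)) p, CharP.cast_eq_zero, map_zero]
    rw [Derivation.leibniz_pow, nsmul_eq_mul, this, zero_mul]

end Reduction

open Polynomial in
theorem dombTrunc_differential_equation (p : ℕ) [Fact p.Prime] :
    (64 * X ^ 2 + 20 * X + 1) * (2 * dombTrunc p * (X * derivative (derivative (dombTrunc p)) +
        derivative (dombTrunc p)) - X * derivative (dombTrunc p) ^ 2)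
      + (20 + 128 * X) * X * dombTrunc p * derivative (dombTrunc p)
      + 8 * (1 + 8 * X) * dombTrunc p ^ 2 = 0 := by
  have h := dombQuadratic_dombTrunc p
  rw [PowerSeries.dombQuadratic, PowerSeries.eulerDeriv_coe, PowerSeries.eulerDeriv_coe] at h
  have e (n : ℕ) [n.AtLeastTwo] :
      ((OfNat.ofNat n : (ZMod p)[X]) : PowerSeries (ZMod p)) = OfNat.ofNat n :=
    map_ofNat Polynomial.coeToPowerSeries.ringHom n
  refine (mul_eq_zero.mp ?_).resolve_left (X_ne_zero (R := ZMod p))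
  apply Polynomial.coe_injective (ZMod p)
  rw [Polynomial.coe_zero, ← h]
  simp only [derivative_mul, derivative_X, Polynomial.coe_add, Polynomial.coe_mul,
    Polynomial.coe_sub, Polynomial.coe_pow, Polynomial.coe_one, Polynomial.coe_X,
    e 2, e 8, e 20, e 64, e 128]
  ring

/-! ### Squarefree parts of polynomials. -/

open Polynomial

theorem Polynomial.exists_eq_sq_mul_squarefree {F : Type*} [Field F] (a : F[X]) (ha : a ≠ 0) :
    ∃ s t : F[X], a = s ^ 2 * t ∧ Squarefree t := by
  induction h : a.natDegree using Nat.strong_induction_on generalizing a with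
  | _ n ih =>
    by_cases hsq : Squarefree a
    · exact ⟨1, a, by ring, hsq⟩
    · simp only [Squarefree, not_forall] at hsq
      obtain ⟨x, ⟨b, hb⟩, hx⟩ := hsq
      have hx0 : x ≠ 0 := by rintro rfl; exact ha (by simpa using hb)
      have hb0 : b ≠ 0 := by rintro rfl; exact ha (by simpa using hb)
      have hdeg : 0 < x.natDegree := natDegree_pos_iff_degree_pos.mpr
        (degree_pos_of_ne_zero_of_nonunit hx0 hx)
      have hlt : b.natDegree < n := by
        rw [← h, hb, natDegree_mul (mul_ne_zero hx0 hx0) hb0, natDegree_mul hx0 hx0]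
        omega
      obtain ⟨s, t, hst, ht⟩ := ih _ hlt b hb0 rfl
      exact ⟨x * s, t, by rw [hb, hst]; ring, ht⟩

theorem Squarefree.dvd_of_forall_irreducible_dvd {F : Type*} [Field F] {a b : F[X]}
    (ha : Squarefree a) (h : ∀ q, Irreducible q → q ∣ a → q ∣ b) : a ∣ b := by
  classical
  obtain ⟨w, hw⟩ := EuclideanDomain.gcd_dvd_left a b
  by_cases hu : IsUnit w
  · have : a ∣ EuclideanDomain.gcd a b := by
      conv_lhs => rw [hw]
      exact hu.mul_right_dvd.mpr dvd_rfl
    exact this.trans (EuclideanDomain.gcd_dvd_right a b)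
  · exfalso
    have hw0 : w ≠ 0 := by rintro rfl; exact ha.ne_zero (by simpa using hw)
    obtain ⟨q, hq, hqw⟩ := WfDvdMonoid.exists_irreducible_factor hu hw0
    have hqa : q ∣ a := hw ▸ hqw.mul_left _
    have hqg := EuclideanDomain.dvd_gcd hqa (h q hq hqa)
    exact hq.not_isUnit (ha q (hw ▸ mul_dvd_mul hqg hqw))

/-! ### Multiplicities of the irreducible factors of the truncation. -/

section Factorization

variable {p : ℕ} [Fact p.Prime]

theorem dombTrunc_coeff_zero : (dombTrunc p).coeff 0 = 1 := by
  rw [coeff_dombTrunc, if_pos (Fact.out : p.Prime).pos, dombAlt_zero, Int.cast_one]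

theorem dombTrunc_ne_zero : dombTrunc p ≠ 0 := by
  intro h
  have := dombTrunc_coeff_zero (p := p)
  simp [h] at this

theorem natDegree_dombTrunc (hp : Odd p) : (dombTrunc p).natDegree = p - 1 := by
  have hp0 := (Fact.out : p.Prime).pos
  apply natDegree_eq_of_le_of_coeff_ne_zero
  · refine natDegree_le_iff_coeff_eq_zero.mpr fun n hn => ?_
    rw [coeff_dombTrunc, if_neg (by omega)]
  · rw [coeff_dombTrunc, if_pos (by omega), cast_dombAlt]
    exact mul_ne_zero (pow_ne_zero _ (by simp)) (cast_domb_pred_ne_zero hp)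

theorem natCast_ne_zero_of_five_le (hp : 5 ≤ p) : (2 : ZMod p) ≠ 0 ∧ (3 : ZMod p) ≠ 0 := by
  have h2 : ((2 : ℕ) : ZMod p) ≠ 0 := by
    rw [Ne, ZMod.natCast_eq_zero_iff]
    exact fun h => absurd (Nat.le_of_dvd (by norm_num) h) (by omega)
  have h3 : ((3 : ℕ) : ZMod p) ≠ 0 := by
    rw [Ne, ZMod.natCast_eq_zero_iff]
    exact fun h => absurd (Nat.le_of_dvd (by norm_num) h) (by omega)
  exact ⟨by exact_mod_cast h2, by exact_mod_cast h3⟩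

theorem isUnit_discriminant (hp : 5 ≤ p) : IsUnit (144 : (ZMod p)[X]) := by
  obtain ⟨h2, h3⟩ := natCast_ne_zero_of_five_le hp
  have : (144 : (ZMod p)[X]) = C (2 ^ 4 * 3 ^ 2 : ZMod p) := by
    rw [show (2 ^ 4 * 3 ^ 2 : ZMod p) = 144 by norm_num]; rfl
  rw [this]
  exact isUnit_C.mpr (mul_ne_zero (pow_ne_zero _ h2) (pow_ne_zero _ h3)).isUnit

theorem pow_dvd_dombTrunc_lt (hp : Odd p) {q : (ZMod p)[X]} (hq : Irreducible q) {m : ℕ}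
    (h : q ^ m ∣ dombTrunc p) : m < p := by
  have h1 := natDegree_le_of_dvd h dombTrunc_ne_zero
  rw [natDegree_pow, natDegree_dombTrunc hp] at h1
  have h2 : m ≤ m * q.natDegree := Nat.le_mul_of_pos_right _ hq.natDegree_pos
  have := (Fact.out : p.Prime).pos
  omega

theorem not_dvd_derivative {q : (ZMod p)[X]} (hq : Irreducible q) : ¬ q ∣ derivative q := by
  intro h
  exact hq.not_isUnit (IsCoprime.isUnit_of_dvd' (PerfectField.separable_of_irreducible hq) dvd_rfl h)

theorem cast_ne_zero_of_lt {e : ℕ} (h0 : e ≠ 0) (h : e < p) : ((e : ℕ) : (ZMod p)[X]) ≠ 0 := by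
  intro hz
  rw [← map_natCast (C : ZMod p →+* (ZMod p)[X]), C_eq_zero, ZMod.natCast_eq_zero_iff] at hz
  exact absurd (Nat.le_of_dvd (Nat.pos_of_ne_zero h0) hz) (by omega)

theorem not_irreducible_dvd_cast {q : (ZMod p)[X]} (hq : Irreducible q) {e : ℕ} (h0 : e ≠ 0)
    (h : e < p) : ¬ q ∣ ((e : ℕ) : (ZMod p)[X]) := by
  intro hd
  have := natDegree_le_of_dvd hd (cast_ne_zero_of_lt h0 h)
  rw [natDegree_natCast] at this
  have := hq.natDegree_pos
  omega

/-- Local form of the differential equation at an irreducible factor. -/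
theorem dombTrunc_local_equation {q c u : (ZMod p)[X]} {e : ℕ} (hq : q ≠ 0)
    (h : dombTrunc p = q ^ (e + 1) * c)
    (hu : u = ((e : (ZMod p)[X]) + 1) * derivative q * c + q * derivative c) :
    (64 * X ^ 2 + 20 * X + 1) * (2 * X * c * ((e : (ZMod p)[X]) * derivative q * u + q * derivative u)
        + 2 * q * c * u - X * u ^ 2)
      + (20 + 128 * X) * X * q * c * u + 8 * (1 + 8 * X) * q ^ 2 * c ^ 2 = 0 := by
  have hode := dombTrunc_differential_equation p
  have h1 : derivative (dombTrunc p) = q ^ e * u := by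
    rw [h, derivative_mul, derivative_pow_succ]
    simp only [hu, map_add, map_natCast, map_one]
    ring
  -- The extra factor q avoids the exponent e - 1, which is truncated at e = 0.
  have h2 : q * derivative (derivative (dombTrunc p)) =
      q ^ e * ((e : (ZMod p)[X]) * derivative q * u + q * derivative u) := by
    rw [h1, derivative_mul]
    obtain _ | e := e
    · simp
    · rw [derivative_pow_succ]
      simp only [map_add, map_natCast, map_one]
      push_cast
      ring
  have h3 : dombTrunc p * derivative (derivative (dombTrunc p)) =
      q ^ e * c * (q ^ e * ((e : (ZMod p)[X]) * derivative q * u + q * derivative u)) := by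
    rw [← h2]; nth_rewrite 1 [h]; ring
  refine (mul_eq_zero.mp ?_).resolve_left (pow_ne_zero (2 * e) hq)
  rw [← hode]
  rw [show (64 * X ^ 2 + 20 * X + 1) * (2 * dombTrunc p * (X * derivative (derivative (dombTrunc p)) +
        derivative (dombTrunc p)) - X * derivative (dombTrunc p) ^ 2)
      + (20 + 128 * X) * X * dombTrunc p * derivative (dombTrunc p)
      + 8 * (1 + 8 * X) * dombTrunc p ^ 2 =
      (64 * X ^ 2 + 20 * X + 1) *
        (2 * X * (dombTrunc p * derivative (derivative (dombTrunc p))) +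
        2 * dombTrunc p * derivative (dombTrunc p) - X * derivative (dombTrunc p) ^ 2)
      + (20 + 128 * X) * X * dombTrunc p * derivative (dombTrunc p)
      + 8 * (1 + 8 * X) * dombTrunc p ^ 2 by ring, h3, h1, h]
  ring

theorem irreducible_not_dvd_X_of_dvd_dombTrunc {q : (ZMod p)[X]} (hq : Irreducible q)
    (h : q ∣ dombTrunc p) : ¬ q ∣ X := by
  intro hX
  have : X ∣ q := (hq.associated_of_dvd irreducible_X hX).symm.dvd
  have := X_dvd_iff.mp (this.trans h)
  rw [dombTrunc_coeff_zero] at this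
  exact one_ne_zero this

/-- An irreducible factor of `dombTrunc p` has multiplicity one or two, according to whether it
divides the leading coefficient of the differential equation. -/
theorem multiplicity_dombTrunc (hp5 : 5 ≤ p) {q c : (ZMod p)[X]} (hq : Irreducible q)
    {m : ℕ} (hm : m ≠ 0) (h : dombTrunc p = q ^ m * c) (hc : ¬ q ∣ c) :
    (q ∣ 64 * X ^ 2 + 20 * X + 1 ∧ m = 1) ∨ (¬ q ∣ 64 * X ^ 2 + 20 * X + 1 ∧ m = 2) := by
  have hodd : Odd p := (Fact.out : p.Prime).odd_of_ne_two (by omega)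
  obtain ⟨e, rfl⟩ := Nat.exists_eq_succ_of_ne_zero hm
  rw [Nat.succ_eq_add_one] at *
  have hlt : e + 1 < p := pow_dvd_dombTrunc_lt hodd hq ⟨c, h⟩
  have hX : ¬ q ∣ X := irreducible_not_dvd_X_of_dvd_dombTrunc hq
    (h ▸ (dvd_pow_self q hm).mul_right c)
  obtain ⟨u, hu⟩ : ∃ u : (ZMod p)[X],
    u = ((e : (ZMod p)[X]) + 1) * derivative q * c + q * derivative c := ⟨_, rfl⟩
  have hloc := dombTrunc_local_equation hq.ne_zero h hu
  have hd := not_dvd_derivative hq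
  have hpr := hq.prime
  have he1 : ¬ q ∣ ((e : (ZMod p)[X]) + 1) := by
    exact_mod_cast not_irreducible_dvd_cast hq hm hlt
  obtain ⟨E, hE⟩ : ∃ E : (ZMod p)[X], E = e := ⟨_, rfl⟩
  rw [← hE] at hloc hu he1
  by_cases hP : q ∣ 64 * X ^ 2 + 20 * X + 1
  · refine Or.inl ⟨hP, ?_⟩
    obtain ⟨r, hr⟩ := hP
    have hr' : (20 + 128 * X : (ZMod p)[X]) = derivative q * r + q * derivative r := by
      rw [← derivative_mul, ← hr]
      have e64 : derivative (64 : (ZMod p)[X]) = 0 := derivative_ofNat 64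
      have e20 : derivative (20 : (ZMod p)[X]) = 0 := derivative_ofNat 20
      simp only [derivative_add, derivative_mul, derivative_X_pow, derivative_X, derivative_one,
        e64, e20, show (C ((2 : ℕ) : ZMod p)) = 2 from map_natCast C 2]
      ring
    -- P has discriminant 144, a unit for p ≥ 5, so q divides P only once.
    have hqr : ¬ q ∣ r := by
      intro hd
      have h1 : q ∣ (20 + 128 * X : (ZMod p)[X]) := by
        rw [hr']; exact dvd_add (hd.mul_left _) (dvd_mul_right _ _)
      have h2 : q ∣ (64 * X ^ 2 + 20 * X + 1 : (ZMod p)[X]) := hr ▸ dvd_mul_right _ _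
      have h3 : q ∣ (144 : (ZMod p)[X]) := by
        rw [show (144 : (ZMod p)[X]) = (20 + 128 * X) * (20 + 128 * X) -
          (64 * X ^ 2 + 20 * X + 1) * 256 by ring]
        exact dvd_sub (h1.mul_right _) (h2.mul_right _)
      exact hq.not_isUnit (isUnit_of_dvd_unit h3 (isUnit_discriminant hp5))
    -- Lowest-order term at q after dividing by q: the P' term contributes, giving m(m - 1) with m =
    -- E + 1.
    have key : q ∣ r * X * derivative q ^ 2 * c ^ 2 * (E + 1) * E := by
      rw [hr', hr] at hloc
      refine ⟨-(r * (2 * X * c * (E * derivative q * derivative c + derivative u) + 2 * c * u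
        - X * (2 * ((E + 1) * derivative q * c) * derivative c + q * derivative c ^ 2))
        + derivative r * X * c * u + derivative q * r * X * c * derivative c
        + 8 * (1 + 8 * X) * c ^ 2), mul_left_cancel₀ hq.ne_zero ?_⟩
      -- Hides u' so that substituting for u leaves it untouched.
      generalize derivative u = u' at *
      rw [hu] at hloc ⊢
      linear_combination hloc
    have : q ∣ E := by
      simpa [hpr.dvd_mul, hqr, hX, hd, hc, he1, hpr.dvd_pow_iff_dvd] using key
    by_contra hne
    exact not_irreducible_dvd_cast hq (by omega : e ≠ 0) (by omega) (hE ▸ this)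
  · refine Or.inr ⟨hP, ?_⟩
    -- Only 2AA'' - A'² contributes at lowest order: 2m(m - 1) - m² = m(m - 2) with m = E + 1.
    have key : q ∣ (64 * X ^ 2 + 20 * X + 1) * X * derivative q ^ 2 * c ^ 2 * (E + 1) *
        (E - 1) := by
      refine ⟨-((64 * X ^ 2 + 20 * X + 1) * (2 * X * c * (E * derivative q * derivative c +
        derivative u) + 2 * c * u
        - X * (2 * ((E + 1) * derivative q * c) * derivative c + q * derivative c ^ 2))
        + (20 + 128 * X) * X * c * u + 8 * (1 + 8 * X) * q * c ^ 2), ?_⟩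
      generalize derivative u = u' at *
      rw [hu] at hloc ⊢
      linear_combination hloc
    have h1 : q ∣ E - 1 := by
      simpa [hpr.dvd_mul, hP, hX, hd, hc, he1, hpr.dvd_pow_iff_dvd] using key
    rw [hE] at h1
    obtain _ | e := e
    · simp at h1
      exact absurd (isUnit_of_dvd_one h1) hq.not_isUnit
    · by_contra hne
      push_cast at h1
      rw [add_sub_cancel_right] at h1
      exact not_irreducible_dvd_cast hq (by omega : e ≠ 0) (by omega) h1

end Factorization

/-! ### The truncation up to squares. -/

section Factorization

variable {p : ℕ} [Fact p.Prime]

theorem eval_dombTrunc :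
    (dombTrunc p).eval (-4⁻¹) = ∑ n ∈ Finset.range p, (domb n : ZMod p) * 4⁻¹ ^ n := by
  rw [dombTrunc, eval_finsetSum]
  refine Finset.sum_congr rfl fun n _ => ?_
  rw [eval_mul, eval_C, eval_pow, eval_X, cast_dombAlt, neg_pow (4⁻¹ : ZMod p)]
  have : ((-1 : ZMod p) ^ n) * (-1) ^ n = 1 := by rw [← mul_pow]; simp
  linear_combination (domb n : ZMod p) * 4⁻¹ ^ n * this

theorem eval_discriminant_factor (hp : Odd p) :
    (64 * X ^ 2 + 20 * X + 1 : (ZMod p)[X]).eval (-4⁻¹) = 0 := by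
  have h4 := four_ne_zero_of_odd hp
  have e (n : ℕ) [n.AtLeastTwo] (x : ZMod p) :
      eval x (OfNat.ofNat n : (ZMod p)[X]) = OfNat.ofNat n := eval_ofNat n x
  simp only [eval_add, eval_mul, eval_pow, eval_X, eval_one, e 64, e 20]
  have : (4 : ZMod p) * 4⁻¹ = 1 := mul_inv_cancel₀ h4
  linear_combination (4 * (4 : ZMod p) * 4⁻¹ - 1) * this

theorem exists_eq_pow_mul_not_dvd {q a : (ZMod p)[X]} (hq : Irreducible q) (ha : a ≠ 0) :
    ∃ n c, a = q ^ n * c ∧ ¬ q ∣ c :=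
  ⟨_, (FiniteMultiplicity.of_prime_left hq.prime ha).exists_eq_pow_mul_and_not_dvd⟩

theorem multiplicity_of_sq (hp5 : 5 ≤ p) {B : (ZMod p)[X]} (hB : dombTrunc p = B ^ 2)
    {q : (ZMod p)[X]} (hq : Irreducible q) (hd : q ∣ dombTrunc p) :
    ¬ q ∣ 64 * X ^ 2 + 20 * X + 1 ∧ ∃ c, ¬ q ∣ c ∧ dombTrunc p = q ^ 2 * c := by
  have hB0 : B ≠ 0 := by rintro rfl; exact dombTrunc_ne_zero (by rw [hB]; ring)
  obtain ⟨n, c, hc, hqc⟩ := exists_eq_pow_mul_not_dvd hq hB0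
  have hA : dombTrunc p = q ^ (2 * n) * c ^ 2 := by rw [hB, hc]; ring
  have hqc2 : ¬ q ∣ c ^ 2 := fun h => hqc (hq.prime.dvd_of_dvd_pow h)
  have hn : n ≠ 0 := by
    rintro rfl
    apply hqc2
    rwa [hA, mul_zero, pow_zero, one_mul] at hd
  obtain ⟨-, h⟩ | ⟨hP, h⟩ := multiplicity_dombTrunc hp5 hq (by omega) hA hqc2
  · omega
  · exact ⟨hP, c ^ 2, hqc2, by rw [hA, h]⟩

theorem exists_sq_or_mul_sq (hp5 : 5 ≤ p) :
    ∃ B : (ZMod p)[X], dombTrunc p = B ^ 2 ∨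
      dombTrunc p = (64 * X ^ 2 + 20 * X + 1) * B ^ 2 := by
  have hodd : Odd p := (Fact.out : p.Prime).odd_of_ne_two (by omega)
  have hA := dombTrunc_ne_zero (p := p)
  obtain ⟨s, t, hst, ht⟩ := exists_eq_sq_mul_squarefree (dombTrunc p) hA
  have hs0 : s ≠ 0 := by rintro rfl; exact hA (by rw [hst]; ring)
  have ht0 := ht.ne_zero
  have hdvd : t ∣ 64 * X ^ 2 + 20 * X + 1 := by
    refine ht.dvd_of_forall_irreducible_dvd fun q hq hqt => ?_
    obtain ⟨n, c, hc, hqc⟩ := exists_eq_pow_mul_not_dvd hq hs0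
    obtain ⟨w, hw⟩ := hqt
    have hqw : ¬ q ∣ w := by
      rintro ⟨v, rfl⟩
      exact hq.not_isUnit (ht q ⟨v, by rw [hw]; ring⟩)
    have hA' : dombTrunc p = q ^ (2 * n + 1) * (c ^ 2 * w) := by rw [hst, hc, hw]; ring
    obtain ⟨hP, -⟩ | ⟨-, h⟩ := multiplicity_dombTrunc hp5 hq (by omega) hA'
      (hq.prime.not_dvd_mul (fun h => hqc (hq.prime.dvd_of_dvd_pow h)) hqw)
    · exact hP
    · omega
  have hconst : s.coeff 0 ^ 2 * t.coeff 0 = 1 := by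
    have := dombTrunc_coeff_zero (p := p)
    rwa [hst, mul_coeff_zero, pow_two s, mul_coeff_zero, ← pow_two] at this
  have hsc : s.coeff 0 ≠ 0 := by intro h; rw [h] at hconst; simp at hconst
  have hscale : C (s.coeff 0) * C (s.coeff 0)⁻¹ = (1 : (ZMod p)[X]) := by
    rw [← C_mul, mul_inv_cancel₀ hsc, C_1]
  -- Since the truncation has constant term 1, normalising s to constant term 1 absorbs the
  -- remaining constant without a square root.
  refine ⟨C (s.coeff 0)⁻¹ * s, ?_⟩
  have hdeg : (64 * X ^ 2 + 20 * X + 1 : (ZMod p)[X]).natDegree ≤ 2 := by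
    compute_degree
  have hP0 : (64 * X ^ 2 + 20 * X + 1 : (ZMod p)[X]) ≠ 0 := by
    intro h
    have := congrArg (fun f => coeff f 0) h
    simp at this
  have htdeg : t.natDegree ≤ 2 := (natDegree_le_of_dvd hdvd hP0).trans hdeg
  have hpar : p - 1 = 2 * s.natDegree + t.natDegree := by
    rw [← natDegree_dombTrunc hodd, hst, natDegree_mul (pow_ne_zero _ hs0) ht0, natDegree_pow]
  obtain ⟨r, hr⟩ := hodd
  -- Degree 1 is excluded because p - 1 is even.
  have : t.natDegree = 0 ∨ t.natDegree = 2 := by omega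
  have hCmul : C (s.coeff 0) ^ 2 * C (t.coeff 0) = (1 : (ZMod p)[X]) := by
    rw [← C_pow, ← C_mul, hconst, C_1]
  obtain h0 | h2 := this
  · left
    rw [hst]
    rw [eq_C_of_natDegree_eq_zero h0]
    linear_combination (s ^ 2 * C (s.coeff 0)⁻¹ ^ 2) * hCmul - s ^ 2 * C (t.coeff 0) *
      (C (s.coeff 0) * C (s.coeff 0)⁻¹ + 1) * hscale
  · right
    obtain ⟨w, hw⟩ := hdvd
    have hw0 : w ≠ 0 := by rintro rfl; exact hP0 (by simpa using hw)
    have hwd : w.natDegree = 0 := by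
      have := natDegree_mul ht0 hw0
      rw [← hw] at this
      omega
    have hwt : w = C (s.coeff 0) ^ 2 := by
      rw [eq_C_of_natDegree_eq_zero hwd] at hw ⊢
      have := congrArg (fun f => coeff f 0) hw
      simp only [coeff_mul_C] at this
      have e : (64 * X ^ 2 + 20 * X + 1 : (ZMod p)[X]).coeff 0 = 1 := by simp
      rw [e] at this
      rw [← C_pow]
      congr 1
      linear_combination (-w.coeff 0) * hconst - s.coeff 0 ^ 2 * this
    rw [hw, hst, hwt]
    linear_combination (-(s ^ 2 * t * (C (s.coeff 0) * C (s.coeff 0)⁻¹ + 1))) * hscale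

theorem exists_factorization (hp5 : 5 ≤ p) :
    ∃ B : (ZMod p)[X], (p % 3 = 1 → dombTrunc p = B ^ 2) ∧
      (p % 3 ≠ 1 → dombTrunc p = (64 * X ^ 2 + 20 * X + 1) * B ^ 2) := by
  have hodd : Odd p := (Fact.out : p.Prime).odd_of_ne_two (by omega)
  have hiff := sum_domb_mul_inv_four_pow_eq_zero_iff hodd
  rw [← eval_dombTrunc] at hiff
  obtain ⟨B, hB | hB⟩ := exists_sq_or_mul_sq hp5
  · refine ⟨B, fun _ => hB, fun h => ?_⟩
    -- The point -1/4 is a root of P, and no factor of a square truncation divides P.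
    exact absurd (dvd_iff_isRoot.mpr (eval_discriminant_factor hodd)) (multiplicity_of_sq hp5 hB
      (irreducible_X_sub_C _) (dvd_iff_isRoot.mpr (hiff.mpr h))).1
  · refine ⟨B, fun h => ?_, fun _ => hB⟩
    refine absurd (hiff.mp ?_) (by simpa using h)
    rw [hB, eval_mul, eval_discriminant_factor hodd, zero_mul]

/-- The polynomial `dombTrunc p` has an irreducible factor of multiplicity two when it is a
square. -/
theorem exists_irreducible_multiplicity_two (hp5 : 5 ≤ p) {B : (ZMod p)[X]}
    (hB : dombTrunc p = B ^ 2) :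
    ∃ q c : (ZMod p)[X], Irreducible q ∧ ¬ q ∣ c ∧ dombTrunc p = q ^ 2 * c := by
  have hodd : Odd p := (Fact.out : p.Prime).odd_of_ne_two (by omega)
  obtain ⟨q, hq, hd⟩ := exists_irreducible_of_natDegree_pos (f := dombTrunc p)
    (by rw [natDegree_dombTrunc hodd]; omega)
  obtain ⟨-, c, hc, h⟩ := multiplicity_of_sq hp5 hB hq hd
  exact ⟨q, c, hq, hc, h⟩

theorem exists_irreducible_multiplicity_one (hp5 : 5 ≤ p) {B : (ZMod p)[X]}
    (hB : dombTrunc p = (64 * X ^ 2 + 20 * X + 1) * B ^ 2) :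
    ∃ q c : (ZMod p)[X], Irreducible q ∧ ¬ q ∣ c ∧ dombTrunc p = q ^ 1 * c := by
  have hodd : Odd p := (Fact.out : p.Prime).odd_of_ne_two (by omega)
  have hq : Irreducible (X - C (-4⁻¹) : (ZMod p)[X]) := irreducible_X_sub_C _
  have hP : (X - C (-4⁻¹) : (ZMod p)[X]) ∣ 64 * X ^ 2 + 20 * X + 1 :=
    dvd_iff_isRoot.mpr (eval_discriminant_factor hodd)
  obtain ⟨n, c, hc, hqc⟩ := exists_eq_pow_mul_not_dvd hq dombTrunc_ne_zero
  have hn : n ≠ 0 := by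
    rintro rfl
    rw [pow_zero, one_mul] at hc
    exact hqc (hc ▸ hB ▸ hP.mul_right _)
  obtain ⟨-, h⟩ | ⟨h, -⟩ := multiplicity_dombTrunc hp5 hq hn hc hqc
  · exact ⟨_, c, hq, hqc, h ▸ hc⟩
  · exact absurd hP h

end Factorization

/-! ### Kummer theory with exponent p - 1. -/

section Kummer

variable {p : ℕ} [Fact p.Prime]

theorem ZMod.exists_isPrimitiveRoot_sub_one (p : ℕ) [Fact p.Prime] :
    ∃ ζ : (ZMod p)ˣ, IsPrimitiveRoot ζ (p - 1) := by
  obtain ⟨ζ, hζ⟩ := IsCyclic.exists_generator (α := (ZMod p)ˣ)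
  refine ⟨ζ, ?_⟩
  have h := orderOf_eq_card_of_forall_mem_zpowers hζ
  rw [Nat.card_eq_fintype_card, ZMod.card_units] at h
  exact h ▸ IsPrimitiveRoot.orderOf ζ

theorem ZMod.natCard_units (p : ℕ) [Fact p.Prime] : Nat.card (ZMod p)ˣ = p - 1 := by
  rw [Nat.card_eq_fintype_card, ZMod.card_units]

variable {K E : Type*} [Field K] [Field E] [Algebra K E]

theorem isSplittingField_of_pow_card_sub_one (φ : ZMod p →+* K) {g : E} {a : K}
    (hg : IntermediateField.adjoin K {g} = ⊤)
    (h : g ^ (p - 1) = algebraMap K E a) : IsSplittingField K E (X ^ (p - 1) - C a) := by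
  have hp : 0 < p - 1 := Nat.sub_pos_of_lt (Fact.out : p.Prime).one_lt
  obtain ⟨ζ, hζ⟩ := ZMod.exists_isPrimitiveRoot_sub_one p
  have hζ' : IsPrimitiveRoot (((algebraMap K E).comp φ) ζ) (p - 1) :=
    (IsPrimitiveRoot.coe_units_iff.mpr hζ).map_of_injective ((algebraMap K E).comp φ).injective
  have halg : IsAlgebraic K g := by
    refine ⟨X ^ (p - 1) - C a, X_pow_sub_C_ne_zero hp a, ?_⟩
    simp [h]
  constructor
  · rw [Polynomial.map_sub, Polynomial.map_pow, Polynomial.map_C, Polynomial.map_X]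
    exact X_pow_sub_C_splits_of_isPrimitiveRoot hζ' h
  · rw [eq_top_iff, ← IntermediateField.top_toSubalgebra, ← hg,
      IntermediateField.adjoin_simple_toSubalgebra_of_isAlgebraic halg]
    apply Algebra.adjoin_mono
    rw [Set.singleton_subset_iff, mem_rootSet_of_ne (X_pow_sub_C_ne_zero hp a)]
    simp [h]

theorem isGalois_of_pow_card_sub_one (φ : ZMod p →+* K) {g : E} {a : K}
    (hg : IntermediateField.adjoin K {g} = ⊤) (ha : a ≠ 0)
    (h : g ^ (p - 1) = algebraMap K E a) : IsGalois K E := by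
  have := isSplittingField_of_pow_card_sub_one φ hg h
  have : CharP K p := charP_of_injective_ringHom φ.injective p
  refine IsGalois.of_separable_splitting_field (p := X ^ (p - 1) - C a)
    (separable_X_pow_sub_C' p _ a (fun hd => ?_) ha)
  have h1 := (Fact.out : p.Prime).one_lt
  exact absurd (Nat.le_of_dvd (by omega) hd) (by omega)

theorem exists_units_mul_of_pow_card_sub_one (φ : ZMod p →+* K) {g : E} {a : K} (hg0 : g ≠ 0)
    (h : g ^ (p - 1) = algebraMap K E a) (σ : E ≃ₐ[K] E) :
    ∃ c : (ZMod p)ˣ, σ g = algebraMap K E (φ c) * g := by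
  have hp : 0 < p - 1 := Nat.sub_pos_of_lt (Fact.out : p.Prime).one_lt
  have : NeZero (p - 1) := ⟨hp.ne'⟩
  obtain ⟨ζ, hζ⟩ := ZMod.exists_isPrimitiveRoot_sub_one p
  have hζ' : IsPrimitiveRoot (((algebraMap K E).comp φ) ζ) (p - 1) :=
    (IsPrimitiveRoot.coe_units_iff.mpr hζ).map_of_injective ((algebraMap K E).comp φ).injective
  have h1 : (σ g / g) ^ (p - 1) = 1 := by
    rw [div_pow, ← map_pow, h, AlgEquiv.commutes, ← h, div_self (pow_ne_zero _ hg0)]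
  obtain ⟨i, -, hi⟩ := hζ'.eq_pow_of_pow_eq_one h1
  refine ⟨ζ ^ i, ?_⟩
  rw [Units.val_pow_eq_pow_val, map_pow, map_pow]
  rw [RingHom.comp_apply] at hi
  rw [hi, div_mul_cancel₀ _ hg0]

theorem exists_kummer_hom (φ : ZMod p →+* K) {g : E} {a : K}
    (hg : IntermediateField.adjoin K {g} = ⊤) (ha : a ≠ 0)
    (h : g ^ (p - 1) = algebraMap K E a) :
    ∃ ι : (E ≃ₐ[K] E) →* (ZMod p)ˣ, (∀ σ, σ g = algebraMap K E (φ (ι σ)) * g) ∧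
      Function.Injective ι ∧ ∃ r : K, algebraMap K E r = g ^ Nat.card ι.range := by
  have hp : 0 < p - 1 := Nat.sub_pos_of_lt (Fact.out : p.Prime).one_lt
  have hg0 : g ≠ 0 := by
    rintro rfl
    rw [zero_pow hp.ne'] at h
    exact ha ((map_eq_zero _).mp h.symm)
  choose f hf using exists_units_mul_of_pow_card_sub_one φ hg0 h
  have hinj : Function.Injective fun c : (ZMod p)ˣ => algebraMap K E (φ c) * g := by
    intro c d hcd
    exact Units.ext (φ.injective ((algebraMap K E).injective (mul_right_cancel₀ hg0 hcd)))
  let ι : (E ≃ₐ[K] E) →* (ZMod p)ˣ := MonoidHom.mk' f fun σ τ => hinj <| by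
    change algebraMap K E (φ (f (σ * τ))) * g = algebraMap K E (φ ↑(f σ * f τ)) * g
    rw [← hf, AlgEquiv.mul_apply, hf τ, map_mul, AlgEquiv.commutes, hf σ, Units.val_mul, map_mul,
      map_mul]
    ring
  have hι : ∀ σ, σ g = algebraMap K E (φ (ι σ)) * g := hf
  refine ⟨ι, hι, fun σ τ hστ => ?_, ?_⟩
  · have hst : σ g = τ g := by rw [hι, hι, hστ]
    ext x
    have hx : x ∈ IntermediateField.adjoin K {g} := hg ▸ IntermediateField.mem_top
    induction hx using IntermediateField.adjoin_induction with
    | mem x hx => rw [Set.mem_singleton_iff.mp hx, hst]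
    | algebraMap x => rw [AlgEquiv.commutes, AlgEquiv.commutes]
    | add x y _ _ hx hy => rw [map_add, map_add, hx, hy]
    | inv x _ hx => rw [map_inv₀, map_inv₀, hx]
    | mul x y _ _ hx hy => rw [map_mul, map_mul, hx, hy]
  · have := isGalois_of_pow_card_sub_one φ hg ha h
    have := isSplittingField_of_pow_card_sub_one φ hg h
    have := IsSplittingField.finiteDimensional E (X ^ (p - 1) - C a)
    -- Each value of `ι` has order dividing that of the image, so this power of g is fixed and
    -- descends to K.
    refine (IsGalois.mem_range_algebraMap_iff_fixed _).mpr fun σ => ?_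
    have hpow : ι σ ^ Nat.card ι.range = 1 := by
      have := pow_card_eq_one' (x := (⟨ι σ, σ, rfl⟩ : ι.range))
      exact congrArg Subtype.val this
    rw [map_pow, hι, mul_pow, ← map_pow, ← map_pow, ← Units.val_pow_eq_pow_val, hpow]
    simp

end Kummer

/-! ### Multiplicities and powers of rational functions. -/

section RationalFunctions

variable {F : Type*} [Field F]

/-- If `r ^ n * A ^ h = 1` for a rational function `r` and a polynomial `A`, then `n` divides
`h` times the multiplicity in `A` of any irreducible polynomial. -/
theorem RatFunc.dvd_mul_multiplicity {r : RatFunc F} {A q c : F[X]} {n h m : ℕ}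
    (hr : r ^ n * algebraMap F[X] (RatFunc F) A ^ h = 1) (hn : n ≠ 0) (hq : Irreducible q) (hqc : ¬ q ∣ c)
    (hA : A = q ^ m * c) : n ∣ h * m := by
  obtain ⟨u, v, hv, rfl⟩ : ∃ u v : F[X], v ≠ 0 ∧ r = algebraMap _ _ u / algebraMap _ _ v :=
    ⟨r.num, r.denom, r.denom_ne_zero, (RatFunc.num_div_denom r).symm⟩
  have hv' : algebraMap F[X] (RatFunc F) v ≠ 0 := by
    rwa [Ne, FaithfulSMul.algebraMap_eq_zero_iff]
  rw [div_pow, div_mul_eq_mul_div, div_eq_one_iff_eq (pow_ne_zero _ hv')] at hr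
  have hpoly : u ^ n * A ^ h = v ^ n := by
    apply FaithfulSMul.algebraMap_injective F[X] (RatFunc F)
    simpa using hr
  have hu : u ≠ 0 := by
    rintro rfl
    rw [zero_pow hn, zero_mul] at hpoly
    exact pow_ne_zero _ hv hpoly.symm
  have hc : c ≠ 0 := by rintro rfl; simp at hqc
  have hm (a : F[X]) (ha : a ≠ 0) : FiniteMultiplicity q a :=
    FiniteMultiplicity.of_prime_left hq.prime ha
  have hA0 : A ≠ 0 := hA ▸ mul_ne_zero (pow_ne_zero _ hq.ne_zero) hc
  have hmA : multiplicity q A = m := multiplicity_eq_of_dvd_of_not_dvd ⟨c, hA⟩ (by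
    rintro ⟨d, hd⟩
    rw [hA, pow_succ, mul_assoc] at hd
    exact hqc ⟨d, mul_left_cancel₀ (pow_ne_zero _ hq.ne_zero) hd⟩)
  have := congrArg (multiplicity q) hpoly
  rw [multiplicity_mul hq.prime (hm _ (mul_ne_zero (pow_ne_zero _ hu) (pow_ne_zero _ hA0))),
    (hm _ hu).multiplicity_pow hq.prime, (hm _ hA0).multiplicity_pow hq.prime,
    (hm _ hv).multiplicity_pow hq.prime, hmA] at this
  exact (Nat.dvd_add_right (dvd_mul_right n (multiplicity q u))).mp (this ▸ dvd_mul_right n _)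

end RationalFunctions

/-! ### The Galois group of the Domb series. -/

section Domb

variable {p : ℕ} [Fact p.Prime]

theorem adjoin_dombGen : IntermediateField.adjoin (RatFunc (ZMod p)) {dombGen p} = ⊤ := by
  apply IntermediateField.lift_injective
  rw [IntermediateField.lift_adjoin_simple, IntermediateField.lift_top]
  rfl

theorem dombGen_pow_mul : dombGen p ^ (p - 1) *
    algebraMap (RatFunc (ZMod p)) (dombField p) (algebraMap _ _ (dombTrunc p)) = 1 := by
  have h1 := (Fact.out : p.Prime).one_lt
  apply Subtype.ext
  change HahnSeries.ofPowerSeries ℤ (ZMod p) (dombSeries p) ^ (p - 1) *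
    algebraMap (RatFunc (ZMod p)) (ZMod p)⸨X⸩ (algebraMap _ _ (dombTrunc p)) = 1
  have hf : HahnSeries.ofPowerSeries ℤ (ZMod p) (dombSeries p) ≠ 0 := by
    rw [Ne, map_eq_zero_iff _ HahnSeries.ofPowerSeries_injective]
    exact dombSeries_ne_zero p
  have hA : HahnSeries.ofPowerSeries ℤ (ZMod p) (dombTrunc p : PowerSeries (ZMod p)) =
      algebraMap (RatFunc (ZMod p)) (ZMod p)⸨X⸩ (algebraMap _ _ (dombTrunc p)) :=
    RatFunc.coe_coe _
  have h := congrArg (HahnSeries.ofPowerSeries ℤ (ZMod p)) (dombSeries_eq_dombTrunc_mul p)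
  rw [map_mul, map_pow, hA, ← pow_sub_one_mul (by omega : p ≠ 0)] at h
  apply mul_right_cancel₀ hf
  rw [one_mul]
  conv_rhs => rw [h]
  ring

theorem algebraMap_dombTrunc_ne_zero :
    algebraMap (ZMod p)[X] (RatFunc (ZMod p)) (dombTrunc p) ≠ 0 := by
  rw [Ne, FaithfulSMul.algebraMap_eq_zero_iff]
  exact dombTrunc_ne_zero

theorem dombGen_pow : dombGen p ^ (p - 1) = algebraMap (RatFunc (ZMod p)) (dombField p)
    (algebraMap _ _ (dombTrunc p))⁻¹ := by
  rw [map_inv₀]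
  exact eq_inv_of_mul_eq_one_left dombGen_pow_mul

theorem dombGen_ne_zero : dombGen p ≠ 0 := by
  intro h
  have := dombGen_pow_mul (p := p)
  have h1 := (Fact.out : p.Prime).one_lt
  rw [h, zero_pow (by omega), zero_mul] at this
  exact zero_ne_one this

/-- The Galois group of the field generated by `f_δ`, with the multiplicities of the irreducible
factors of `dombTrunc p` as lower bound. -/
theorem exists_dombGaloisHom :
    ∃ ι : (dombField p ≃ₐ[RatFunc (ZMod p)] dombField p) →* (ZMod p)ˣ,
      DombGaloisGroupEq p ι.range ∧
      (∀ σ, σ (dombGen p) =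
        algebraMap (RatFunc (ZMod p)) (dombField p) (RatFunc.C (ι σ : ZMod p)) * dombGen p) ∧
      ∀ q c : (ZMod p)[X], ∀ m : ℕ, Irreducible q → ¬ q ∣ c → dombTrunc p = q ^ m * c →
        p - 1 ∣ Nat.card ι.range * m := by
  have h1 := (Fact.out : p.Prime).one_lt
  have hA := inv_ne_zero (algebraMap_dombTrunc_ne_zero (p := p))
  obtain ⟨ι, hι, hinj, r, hr⟩ := exists_kummer_hom (RatFunc.C : ZMod p →+* RatFunc (ZMod p))
    adjoin_dombGen hA dombGen_pow
  refine ⟨ι, ⟨isGalois_of_pow_card_sub_one (RatFunc.C : ZMod p →+* RatFunc (ZMod p))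
    adjoin_dombGen hA dombGen_pow, ι, fun σ => ?_, hinj, rfl⟩, hι, ?_⟩
  · rw [hι, mul_div_cancel_right₀ _ dombGen_ne_zero]
  · intro q c m hq hqc hm
    refine RatFunc.dvd_mul_multiplicity (r := r) (h := Nat.card ι.range) ?_ (by omega) hq hqc hm
    apply (algebraMap (RatFunc (ZMod p)) (dombField p)).injective
    rw [map_mul, map_pow, map_pow, hr, map_one, ← pow_mul, mul_comm (Nat.card _), pow_mul,
      ← mul_pow, dombGen_pow_mul, one_pow]

theorem dombGaloisGroupEq_top (hp5 : 5 ≤ p) {B : (ZMod p)[X]}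
    (hB : dombTrunc p = (64 * X ^ 2 + 20 * X + 1) * B ^ 2) : DombGaloisGroupEq p ⊤ := by
  obtain ⟨ι, hG, -, hm⟩ := exists_dombGaloisHom (p := p)
  obtain ⟨q, c, hq, hqc, h⟩ := exists_irreducible_multiplicity_one hp5 hB
  have := hm q c 1 hq hqc h
  rw [mul_one] at this
  have htop : ι.range = ⊤ := by
    apply Subgroup.eq_top_of_le_card
    rw [ZMod.natCard_units]
    exact Nat.le_of_dvd Nat.card_pos this
  exact htop ▸ hG

/-- By Euler's criterion squares solve x^((p-1)/2) = 1, which has at most (p - 1)/2 solutions in a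
cyclic group. -/
theorem card_square_le (hp : Odd p) : Nat.card (Subgroup.square (ZMod p)ˣ) ≤ p / 2 := by
  classical
  have h1 := (Fact.out : p.Prime).one_lt
  obtain ⟨k, hk⟩ := hp
  refine le_trans ?_ (IsCyclic.card_pow_eq_one_le (α := (ZMod p)ˣ) (n := p / 2) (by omega))
  rw [← Set.ncard_coe_finset]
  refine Set.ncard_le_ncard (s := (Subgroup.square (ZMod p)ˣ : Set (ZMod p)ˣ)) fun x hx => ?_
  obtain ⟨y, rfl⟩ := Subgroup.mem_square.mp hx
  simpa using (ZMod.euler_criterion_units p (y * y)).mp ⟨y, sq y⟩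

theorem dombGaloisGroupEq_square (hp5 : 5 ≤ p) {B : (ZMod p)[X]}
    (hB : dombTrunc p = B ^ 2) : DombGaloisGroupEq p (Subgroup.square (ZMod p)ˣ) := by
  have hodd : Odd p := (Fact.out : p.Prime).odd_of_ne_two (by omega)
  obtain ⟨ι, hG, hι, hm⟩ := exists_dombGaloisHom (p := p)
  obtain ⟨q, c, hq, hqc, h⟩ := exists_irreducible_multiplicity_two hp5 hB
  have hdvd := hm q c 2 hq hqc h
  have hle : ι.range ≤ Subgroup.square (ZMod p)ˣ := by
    rintro _ ⟨σ, rfl⟩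
    rw [Subgroup.mem_square]
    have hsq := dombGen_pow_mul (p := p)
    obtain ⟨b, hb⟩ : ∃ b, b = algebraMap (RatFunc (ZMod p)) (dombField p) (algebraMap _ _ B) :=
      ⟨_, rfl⟩
    have hpp : p - 1 = p / 2 * 2 := by obtain ⟨k, hk⟩ := hodd; omega
    rw [hB, map_pow, map_pow, hpp, pow_mul, ← mul_pow, ← hb] at hsq
    have hne : dombGen p ^ (p / 2) * b ≠ 0 := by
      intro h0; rw [h0] at hsq; simp at hsq
    have hfix : σ (dombGen p ^ (p / 2) * b) = dombGen p ^ (p / 2) * b := by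
      -- The element squares to 1, so it is ±1 and lies in the base field.
      obtain h | h := mul_self_eq_one_iff.mp ((sq _).symm.trans hsq) <;> rw [h] <;> simp
    have hc : ι σ ^ (p / 2) = 1 := by
      rw [map_mul, map_pow, hι, mul_pow, hb, AlgEquiv.commutes, ← hb, mul_assoc] at hfix
      have h1 := mul_right_cancel₀ hne (hfix.trans (one_mul _).symm)
      rw [← map_pow, ← map_pow] at h1
      apply Units.ext
      apply (RatFunc.C : ZMod p →+* RatFunc (ZMod p)).injective
      apply (algebraMap (RatFunc (ZMod p)) (dombField p)).injective
      rw [Units.val_pow_eq_pow_val, h1]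
      simp
    obtain ⟨y, hy⟩ := (ZMod.euler_criterion_units p (ι σ)).mpr hc
    exact ⟨y, by rw [← hy, sq]⟩
  have heq : ι.range = Subgroup.square (ZMod p)ˣ := by
    refine Subgroup.eq_of_le_of_card_ge hle ((card_square_le hodd).trans ?_)
    have := Nat.le_of_dvd (Nat.mul_pos Nat.card_pos two_pos) hdvd
    omega
  exact heq ▸ hG

end Domb

theorem theorem3 (p : ℕ) [Fact p.Prime] :
    ∃ B : Polynomial (ZMod p),
      (p ≡ 1 [MOD 6] →
        dombTrunc p = B ^ 2 ∧ DombGaloisGroupEq p (Subgroup.square (ZMod p)ˣ)) ∧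
      (p ≡ 5 [MOD 6] →
        dombTrunc p =
            (64 * Polynomial.X ^ 2 + 20 * Polynomial.X + 1) * B ^ 2 ∧
          DombGaloisGroupEq p ⊤) := by
  have h1 := (Fact.out : p.Prime).one_lt
  obtain hp | hp := lt_or_ge p 5
  -- The primes 2 and 3 satisfy neither congruence, so any witness serves.
  · refine ⟨0, fun h => ?_, fun h => ?_⟩ <;>
    · rw [Nat.ModEq] at h; omega
  obtain ⟨B, hB1, hB2⟩ := exists_factorization hp
  refine ⟨B, fun h => ?_, fun h => ?_⟩
  · have := hB1 (by rw [Nat.ModEq] at h; omega)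
    exact ⟨this, dombGaloisGroupEq_square hp this⟩
  · have := hB2 (by rw [Nat.ModEq] at h; omega)
    exact ⟨this, dombGaloisGroupEq_top hp this⟩
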